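/- Let $\Gamma$ be a compact connected metric graph, that is, the space obtained from a finite connected graph $G=(V,E)$ (loops and parallel edges allowed) by identifying each edge $e$ with an interval $[0,\ell(e)]$ of length $\ell(e)>0$. Let $g=\dim H_1(\Gamma,\mathbb{R})$ be its genus, and suppose $g\ge 2$. Let $\mathrm{Div}(\Gamma)$ be the free abelian group on the points of $\Gamma$ and $\mathrm{Div}^0(\Gamma)$ the subgroup of divisors of degree zero. Let $\mathrm{PL}_{\mathbb{Z}}(\Gamma)$ be the group of continuous functions $f:\Gamma\to\mathbb{R}$ for which, after a finite subdivision of the edges, $f$ is linear with integer slope on every edge. The divisor of such an $f$ is $\mathrm{div}(f)=-\sum_{x\in\Gamma}a_x\,x$, where $a_x$ is the sum of the outgoing slopes of $f$ at $x$. Let $\mathrm{Jac}(\Gamma)=\mathrm{Div}^0(\Gamma)/\mathrm{div}(\mathrm{PL}_{\mathbb{Z}}(\Gamma))$, with torsion subgroup $\mathrm{Jac}(\Gamma)_{\mathrm{tors}}$. For a point $q\in\Gamma$ let $\Phi_q:\Gamma\to\mathrm{Jac}(\Gamma)$, $x\mapsto[x-q]$, be the Abel--Jacobi map. If $\Phi_q(\Gamma)\cap\mathrm{Jac}(\Gamma)_{\mathrm{tors}}$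 is finite, then $$\#\bigl(\Phi_q(\Gamma)\cap\mathrm{Jac}(\Gamma)_{\mathrm{tors}}\bigr)\le 3g-3 .$$ -/

import Mathlib

open Set Filter Topology

/-- A (compact, connected) metric graph, given by a combinatorial model `(G, ℓ)`: a connected
oriented graph `G` with vertex set `V` and edge set `E` (loops and parallel edges allowed; both
sets are taken finite wherever the structure is used) together with positive real edge lengths.
The edge `e` is identified with the interval `[0, ℓ e]`, running from `tail e` to `head e`. -/
structure MetricGraph (V E : Type*) where
  tail : E → V
  head : E → V
  /-- the edge lengths `ℓ` -/
  length : E → ℝ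
  length_pos : ∀ e, 0 < length e
  nonempty : Nonempty V
  /-- any two vertices are joined by a path of edges, traversed in either direction -/
  connected : ∀ u v : V, Relation.EqvGen (fun a b => ∃ e, tail e = a ∧ head e = b) u v

namespace MetricGraph

variable {V E : Type*} (Γ : MetricGraph V E)

/-- The points of the metric graph: the vertices, and the interior points of the edges. This is
the disjoint union of `V` and of the intervals `[0, ℓ e]`, with the ends `0` and `ℓ e` glued to
`tail e` and `head e`. -/
inductive Point : Type _
  | vertex (v : V) : Point
  | interior (e : E) (t : ℝ) (ht : t ∈ Ioo 0 (Γ.length e)) : Point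

open Classical in
/-- The length-preserving parametrization of the edge `e` by `[0, ℓ e]` (extended to all of `ℝ`
by the constant values `tail e` on the left and `head e` on the right). -/
noncomputable def point (e : E) (t : ℝ) : Γ.Point :=
  if ht : t ∈ Ioo 0 (Γ.length e) then .interior e t ht
  else if t ≤ 0 then .vertex (Γ.tail e) else .vertex (Γ.head e)

section Genus

variable [Fintype E] [DecidableEq V]

/-- The boundary map `C₁(Γ, ℝ) → C₀(Γ, ℝ)` of the cellular chain complex, `e ↦ head e - tail e`. -/
noncomputable def boundary : (E → ℝ) →ₗ[ℝ] (V → ℝ) :=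
  ∑ e, (LinearMap.proj e).smulRight (Pi.single (Γ.head e) 1 - Pi.single (Γ.tail e) 1)

/-- The genus, the dimension of `H₁(Γ, ℝ)`. There are no cells of dimension two, so `H₁(Γ, ℝ)` is
the kernel of the boundary map. -/
noncomputable def genus : ℕ := Module.finrank ℝ (LinearMap.ker Γ.boundary)

end Genus

/-- The group `PL_ℤ(Γ)` of piecewise `ℤ`-linear functions: after subdividing the graph at a finite
set `S` of points, `f` is linear with integer slope on every edge, that is, on every closed
segment of an edge of `Γ` that has no point of `S` in its interior. (Such an `f` is continuous,
as the segments are closed and `f` is a function of the points of `Γ`.) -/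
def PLZ : AddSubgroup (Γ.Point → ℝ) where
  carrier := {f | ∃ S : Finset Γ.Point, ∀ e a b, 0 ≤ a → a ≤ b → b ≤ Γ.length e →
    (∀ t ∈ Ioo a b, Γ.point e t ∉ S) →
      ∃ m : ℤ, ∀ t ∈ Icc a b, f (Γ.point e t) = f (Γ.point e a) + m * (t - a)}
  add_mem' := by
    classical
    rintro f g ⟨S, hS⟩ ⟨T, hT⟩
    refine ⟨S ∪ T, fun e a b ha hab hb h => ?_⟩
    obtain ⟨m, hm⟩ := hS e a b ha hab hb fun t ht h' => h t ht (Finset.mem_union_left _ h')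
    obtain ⟨n, hn⟩ := hT e a b ha hab hb fun t ht h' => h t ht (Finset.mem_union_right _ h')
    refine ⟨m + n, fun t ht => ?_⟩
    simp only [Pi.add_apply, hm t ht, hn t ht]
    push_cast
    ring
  zero_mem' := ⟨∅, fun _ _ _ _ _ _ _ => ⟨0, fun _ _ => by simp⟩⟩
  neg_mem' := by
    rintro f ⟨S, hS⟩
    refine ⟨S, fun e a b ha hab hb h => ?_⟩
    obtain ⟨m, hm⟩ := hS e a b ha hab hb h
    refine ⟨-m, fun t ht => ?_⟩
    simp only [Pi.neg_apply, hm t ht]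
    push_cast
    ring

/-- The slope of `f` at the point of `e` with parameter `t`, in the direction of `head e`. -/
noncomputable def slopeRight (f : Γ.Point → ℝ) (e : E) (t : ℝ) : ℝ :=
  derivWithin (fun s => f (Γ.point e s)) (Ioi t) t

/-- The slope of `f` at the point of `e` with parameter `t`, in the direction of `tail e`. -/
noncomputable def slopeLeft (f : Γ.Point → ℝ) (e : E) (t : ℝ) : ℝ :=
  -derivWithin (fun s => f (Γ.point e s)) (Iio t) t

/-- The coefficient at a point of the divisor of `f`: minus the sum of the outgoing slopes
of `f` at that point. A loop at a vertex contributes two outgoing slopes. -/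
noncomputable def laplacian [Fintype E] [DecidableEq V] (f : Γ.Point → ℝ) : Γ.Point → ℝ
  | .vertex v => -∑ e, ((if Γ.tail e = v then Γ.slopeRight f e 0 else 0)
      + (if Γ.head e = v then Γ.slopeLeft f e (Γ.length e) else 0))
  | .interior e t _ => -(Γ.slopeRight f e t + Γ.slopeLeft f e t)

variable {Γ}

theorem finite_param (S : Finset Γ.Point) (e : E) :
    {s | s ∈ Ioo 0 (Γ.length e) ∧ Γ.point e s ∈ S}.Finite := by
  refine Set.Finite.of_finite_image (f := Γ.point e)
    (S.finite_toSet.subset (by rintro _ ⟨s, hs, rfl⟩; exact hs.2)) ?_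
  rintro s ⟨hs, _⟩ t ⟨ht, _⟩ h
  simp only [point, dif_pos hs, dif_pos ht] at h
  exact (Point.interior.inj h).2

/-- A piecewise `ℤ`-linear function has an integer slope in the direction of `head e`. -/
theorem hasDerivWithinAt_right {f : Γ.Point → ℝ} (hf : f ∈ Γ.PLZ) (e : E) {t : ℝ}
    (h0 : 0 ≤ t) (h1 : t < Γ.length e) :
    ∃ m : ℤ, HasDerivWithinAt (fun s => f (Γ.point e s)) m (Ioi t) t := by
  obtain ⟨S, hS⟩ := hf
  have hfin := (finite_param S e).subset (sdiff_subset (t := {t}))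
  have hev : ∀ᶠ s in 𝓝 t,
      s ∉ {s | s ∈ Ioo 0 (Γ.length e) ∧ Γ.point e s ∈ S} \ {t} :=
    hfin.isClosed.compl_mem_nhds (by simp)
  obtain ⟨ε, hε, hball⟩ := Metric.eventually_nhds_iff.1 hev
  set b := min (Γ.length e) (t + ε / 2) with hb
  have htb : t < b := lt_min h1 (by linarith)
  obtain ⟨m, hm⟩ := hS e t b h0 htb.le (min_le_left _ _) fun s hs hsS => by
    have hs1 : s < Γ.length e := hs.2.trans_le (min_le_left _ _)
    have hs2 : s < t + ε / 2 := hs.2.trans_le (min_le_right _ _)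
    refine hball (y := s) ?_ ⟨⟨⟨h0.trans_lt hs.1, hs1⟩, hsS⟩, hs.1.ne'⟩
    rw [Real.dist_eq, abs_lt]
    constructor <;> linarith [hs.1]
  refine ⟨m, ?_⟩
  have hlin : HasDerivWithinAt (fun s => f (Γ.point e t) + m * (s - t)) (m : ℝ) (Ioi t) t := by
    simpa using
      ((((hasDerivAt_id t).sub_const t).const_mul (m : ℝ)).const_add
        (f (Γ.point e t))).hasDerivWithinAt
  refine hlin.congr_of_eventuallyEq ?_ (by simp)
  filter_upwards [Ioo_mem_nhdsGT htb] with s hs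
  exact hm s ⟨hs.1.le, hs.2.le⟩

/-- A piecewise `ℤ`-linear function has an integer slope in the direction of `tail e`. -/
theorem hasDerivWithinAt_left {f : Γ.Point → ℝ} (hf : f ∈ Γ.PLZ) (e : E) {t : ℝ}
    (h0 : 0 < t) (h1 : t ≤ Γ.length e) :
    ∃ m : ℤ, HasDerivWithinAt (fun s => f (Γ.point e s)) m (Iio t) t := by
  obtain ⟨S, hS⟩ := hf
  have hfin := (finite_param S e).subset (sdiff_subset (t := {t}))
  have hev : ∀ᶠ s in 𝓝 t,
      s ∉ {s | s ∈ Ioo 0 (Γ.length e) ∧ Γ.point e s ∈ S} \ {t} :=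
    hfin.isClosed.compl_mem_nhds (by simp)
  obtain ⟨ε, hε, hball⟩ := Metric.eventually_nhds_iff.1 hev
  set a := max 0 (t - ε / 2) with ha
  have hat : a < t := max_lt h0 (by linarith)
  obtain ⟨m, hm⟩ := hS e a t (le_max_left _ _) hat.le h1 fun s hs hsS => by
    have hs1 : 0 < s := (le_max_left _ _).trans_lt hs.1
    have hs2 : t - ε / 2 < s := (le_max_right _ _).trans_lt hs.1
    refine hball (y := s) ?_ ⟨⟨⟨hs1, hs.2.trans_le h1⟩, hsS⟩, hs.2.ne⟩
    rw [Real.dist_eq, abs_lt]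
    constructor <;> linarith [hs.2]
  refine ⟨m, ?_⟩
  have hlin : HasDerivWithinAt (fun s => f (Γ.point e a) + m * (s - a)) (m : ℝ) (Iio t) t := by
    simpa using
      ((((hasDerivAt_id t).sub_const a).const_mul (m : ℝ)).const_add
        (f (Γ.point e a))).hasDerivWithinAt
  refine hlin.congr_of_eventuallyEq ?_ (hm t ⟨hat.le, le_rfl⟩)
  filter_upwards [Ioo_mem_nhdsLT hat] with s hs
  exact hm s ⟨hs.1.le, hs.2.le⟩

theorem slopeRight_add {f g : Γ.Point → ℝ} (hf : f ∈ Γ.PLZ) (hg : g ∈ Γ.PLZ) (e : E) {t : ℝ}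
    (h0 : 0 ≤ t) (h1 : t < Γ.length e) :
    Γ.slopeRight (f + g) e t = Γ.slopeRight f e t + Γ.slopeRight g e t := by
  obtain ⟨m, hm⟩ := hasDerivWithinAt_right hf e h0 h1
  obtain ⟨n, hn⟩ := hasDerivWithinAt_right hg e h0 h1
  exact derivWithin_fun_add hm.differentiableWithinAt hn.differentiableWithinAt

theorem slopeLeft_add {f g : Γ.Point → ℝ} (hf : f ∈ Γ.PLZ) (hg : g ∈ Γ.PLZ) (e : E) {t : ℝ}
    (h0 : 0 < t) (h1 : t ≤ Γ.length e) :
    Γ.slopeLeft (f + g) e t = Γ.slopeLeft f e t + Γ.slopeLeft g e t := by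
  obtain ⟨m, hm⟩ := hasDerivWithinAt_left hf e h0 h1
  obtain ⟨n, hn⟩ := hasDerivWithinAt_left hg e h0 h1
  have h : derivWithin (fun s => (f + g) (Γ.point e s)) (Iio t) t = _ :=
    derivWithin_fun_add hm.differentiableWithinAt hn.differentiableWithinAt
  rw [slopeLeft, h, slopeLeft, slopeLeft, neg_add]

theorem slopeRight_neg (f : Γ.Point → ℝ) (e : E) (t : ℝ) :
    Γ.slopeRight (-f) e t = -Γ.slopeRight f e t :=
  derivWithin.fun_neg

theorem slopeLeft_neg (f : Γ.Point → ℝ) (e : E) (t : ℝ) :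
    Γ.slopeLeft (-f) e t = -Γ.slopeLeft f e t :=
  congrArg Neg.neg derivWithin.fun_neg

section Jacobian

variable [Fintype E] [DecidableEq V]

theorem laplacian_add {f g : Γ.Point → ℝ} (hf : f ∈ Γ.PLZ) (hg : g ∈ Γ.PLZ) (p : Γ.Point) :
    Γ.laplacian (f + g) p = Γ.laplacian f p + Γ.laplacian g p := by
  cases p with
  | vertex v =>
    simp only [laplacian]
    rw [← neg_add, ← Finset.sum_add_distrib]
    congr 1
    refine Finset.sum_congr rfl fun e _ => ?_
    rw [slopeRight_add hf hg e le_rfl (Γ.length_pos e),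
      slopeLeft_add hf hg e (Γ.length_pos e) le_rfl]
    split_ifs <;> ring
  | interior e t ht =>
    simp only [laplacian]
    rw [slopeRight_add hf hg e ht.1.le ht.2, slopeLeft_add hf hg e ht.1 ht.2.le]
    ring

theorem laplacian_neg (f : Γ.Point → ℝ) (p : Γ.Point) :
    Γ.laplacian (-f) p = -Γ.laplacian f p := by
  cases p with
  | vertex v =>
    simp only [laplacian, slopeRight_neg, slopeLeft_neg]
    rw [neg_inj, ← Finset.sum_neg_distrib]
    refine Finset.sum_congr rfl fun e _ => ?_
    split_ifs <;> ring
  | interior e t ht =>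
    simp only [laplacian, slopeRight_neg, slopeLeft_neg]
    ring

variable (Γ)

/-- The group `Div(Γ)` of divisors: the free abelian group on the points of `Γ`. -/
abbrev Divisor : Type _ := Γ.Point →₀ ℤ

/-- The degree of a divisor. -/
noncomputable def degree : Γ.Divisor →+ ℤ :=
  Finsupp.liftAddHom (fun _ : Γ.Point => AddMonoidHom.id ℤ)

/-- The group of divisors of degree zero. -/
noncomputable abbrev DivisorZero : AddSubgroup Γ.Divisor := Γ.degree.ker

/-- The group of principal divisors: the divisors of the piecewise `ℤ`-linear functions. -/
noncomputable def principal : AddSubgroup Γ.Divisor where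
  carrier := {D | ∃ f ∈ Γ.PLZ, ∀ p, (D p : ℝ) = Γ.laplacian f p}
  add_mem' := by
    rintro D D' ⟨f, hf, hD⟩ ⟨g, hg, hD'⟩
    refine ⟨f + g, add_mem hf hg, fun p => ?_⟩
    rw [laplacian_add hf hg, ← hD, ← hD', Finsupp.add_apply, Int.cast_add]
  zero_mem' := by
    refine ⟨0, zero_mem _, fun p => ?_⟩
    have h := laplacian_neg (Γ := Γ) 0 p
    rw [neg_zero] at h
    rw [Finsupp.zero_apply, Int.cast_zero]
    linarith
  neg_mem' := by
    rintro D ⟨f, hf, hD⟩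
    refine ⟨-f, neg_mem hf, fun p => ?_⟩
    rw [laplacian_neg, ← hD, Finsupp.neg_apply, Int.cast_neg]

/-- The Jacobian: divisors of degree zero modulo principal divisors. -/
abbrev Jac : Type _ := Γ.DivisorZero ⧸ Γ.principal.addSubgroupOf Γ.DivisorZero

/-- The Abel-Jacobi map with basepoint `q`, which sends `x` to the class of `x - q`. -/
noncomputable def abelJacobi (q x : Γ.Point) : Γ.Jac :=
  QuotientAddGroup.mk ⟨Finsupp.single x 1 - Finsupp.single q 1, by
    rw [AddMonoidHom.mem_ker, map_sub]; simp [degree]⟩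

end Jacobian

end MetricGraph

/-! By Abel's theorem (`mem_principal_iff`, `jacPeriod_injective`) the Jacobian embeds in the
quotient of `ℤ^V × H₁(Γ, ℝ)*` by the periods of integer `1`-chains. There the class of a point moves
affinely along an edge `e`, in the direction of the coordinate functional `φ = edgeForm e`
(`pointClass_point`). On a bridge `φ = 0` and the class is constant, so bridges can be contracted.
On any other edge, distinct interior points have distinct classes (`formClass_ne_zero`).

Put two edges of the contracted graph in series if a chain through vertices of degree two joins
them. Conservation of flow gives them the same functional up to sign. If a series class carried two
different torsion classes, these would differ by some `L • φ` with `L > 0`, which would itself be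
torsion. All its rational multiples would then be torsion, producing infinitely many torsion points
on one edge (`infinite_torsion`). Under the finiteness hypothesis, each series class therefore
carries at most one torsion class (`pointClass_eq_of_series`).

It remains to count series classes (`card_series_le`). The contracted graph is connected, has all
degrees at least two and, as `g ≥ 2`, is not a cycle. Its series classes are the edges left after
suppressing the vertices of degree two, and a graph of genus `g` with all degrees at least three has
at most `3g - 3` edges. -/

/-! ### One-sided germs of piecewise affine functions of a real variable. -/

/-- `F` is affine with slope `m` on a right neighbourhood of `t`. -/
def RightGerm (F : ℝ → ℝ) (t m : ℝ) : Prop := ∀ᶠ s in 𝓝[>] t, F s = F t + m * (s - t)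

/-- `F` is affine with slope `m` on a left neighbourhood of `t`. -/
def LeftGerm (F : ℝ → ℝ) (t m : ℝ) : Prop := ∀ᶠ s in 𝓝[<] t, F s = F t + m * (s - t)

theorem hasDerivAt_affine (c m t : ℝ) : HasDerivAt (fun s => c + m * (s - t)) m t := by
  simpa using (((hasDerivAt_id t).sub_const t).const_mul m).const_add c

theorem RightGerm.derivWithin_eq {F : ℝ → ℝ} {t m : ℝ} (h : RightGerm F t m) :
    derivWithin F (Ioi t) t = m :=
  ((hasDerivAt_affine (F t) m t).hasDerivWithinAt.congr_of_eventuallyEq h (by simp)).derivWithin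
    (uniqueDiffWithinAt_Ioi t)

theorem LeftGerm.derivWithin_eq {F : ℝ → ℝ} {t m : ℝ} (h : LeftGerm F t m) :
    derivWithin F (Iio t) t = m :=
  ((hasDerivAt_affine (F t) m t).hasDerivWithinAt.congr_of_eventuallyEq h (by simp)).derivWithin
    (uniqueDiffWithinAt_Iio t)

theorem RightGerm.sub {F G : ℝ → ℝ} {t m n : ℝ} (hF : RightGerm F t m) (hG : RightGerm G t n) :
    RightGerm (fun s => F s - G s) t (m - n) := by
  filter_upwards [hF, hG] with s h1 h2
  rw [h1, h2]; ring

theorem LeftGerm.sub {F G : ℝ → ℝ} {t m n : ℝ} (hF : LeftGerm F t m) (hG : LeftGerm G t n) :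
    LeftGerm (fun s => F s - G s) t (m - n) := by
  filter_upwards [hF, hG] with s h1 h2
  rw [h1, h2]; ring

theorem RightGerm.congr {F G : ℝ → ℝ} {a b t m : ℝ} (hF : RightGerm F t m)
    (h : ∀ s ∈ Icc a b, F s = G s) (h1 : a ≤ t) (h2 : t < b) : RightGerm G t m := by
  filter_upwards [hF, Ioo_mem_nhdsGT h2] with s hs hs'
  rw [← h s ⟨h1.trans hs'.1.le, hs'.2.le⟩, ← h t ⟨h1, h2.le⟩, hs]

theorem LeftGerm.congr {F G : ℝ → ℝ} {a b t m : ℝ} (hF : LeftGerm F t m)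
    (h : ∀ s ∈ Icc a b, F s = G s) (h1 : a < t) (h2 : t ≤ b) : LeftGerm G t m := by
  filter_upwards [hF, Ioo_mem_nhdsLT h1] with s hs hs'
  rw [← h s ⟨hs'.1.le, hs'.2.le.trans h2⟩, ← h t ⟨h1.le, h2⟩, hs]

/-- The affine germ is continuous at `t`, so its value there is the limit `0`; one nearby point then
forces the slope to vanish. -/
theorem LeftGerm.eq_zero_of_eventually {F : ℝ → ℝ} {t m : ℝ} (h : LeftGerm F t m)
    (h0 : ∀ᶠ s in 𝓝[<] t, F s = 0) : F t = 0 ∧ m = 0 := by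
  have h1 : ∀ᶠ s in 𝓝[<] t, F t + m * (s - t) = 0 := by
    filter_upwards [h, h0] with s hs hs'
    rw [← hs, hs']
  have ht : Tendsto (fun s => F t + m * (s - t)) (𝓝[<] t) (𝓝 (F t)) := by
    have : Tendsto (fun s => F t + m * (s - t)) (𝓝 t) (𝓝 (F t + m * (t - t))) :=
      (by fun_prop : Continuous fun s => F t + m * (s - t)).tendsto t
    rw [sub_self, mul_zero, add_zero] at this
    exact this.mono_left nhdsWithin_le_nhds
  have hF : F t = 0 := tendsto_nhds_unique (ht.congr' h1) tendsto_const_nhds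
  refine ⟨hF, ?_⟩
  obtain ⟨s, hs, hst⟩ := (h1.and self_mem_nhdsWithin).exists
  rw [hF, zero_add] at hs
  exact (mul_eq_zero.1 hs).resolve_right (sub_ne_zero.2 (ne_of_lt hst))

/-- A piecewise affine function that starts as zero and has no breaks is zero. -/
theorem eq_zero_of_germs {K r l : ℝ → ℝ} {b : ℝ} (hb : 0 < b)
    (hr : ∀ t, 0 ≤ t → t < b → RightGerm K t (r t)) (hl : ∀ t, 0 < t → t ≤ b → LeftGerm K t (l t))
    (hrl : ∀ t ∈ Ioo 0 b, r t = l t) (h0 : K 0 = 0) (hr0 : r 0 = 0) :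
    (∀ t ∈ Icc 0 b, K t = 0) ∧ l b = 0 := by
  -- Real induction. The strict bound `u < t` makes `s` closed with no continuity assumption on `K`.
  set s : Set ℝ := {t | ∀ u, 0 ≤ u → u < t → K u = 0} with hs
  have hleft : ∀ t, 0 < t → t ≤ b → t ∈ s → K t = 0 ∧ l t = 0 := fun t h1 h2 hts =>
    (hl t h1 h2).eq_zero_of_eventually <| by
      filter_upwards [Ioo_mem_nhdsLT h1] with u hu using hts u hu.1.le hu.2
  have hclosed : IsClosed s := by
    have : s = ⋂ u ∈ {u | 0 ≤ u ∧ K u ≠ 0}, Iic u := by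
      ext t
      simp only [hs, mem_ofPred_eq, mem_iInter, mem_Iic]
      constructor
      · intro h u hu
        by_contra! hlt
        exact hu.2 (h u hu.1 hlt)
      · intro h u hu hut
        by_contra hne
        exact absurd (h u ⟨hu, hne⟩) (not_le.2 hut)
    rw [this]
    exact isClosed_biInter fun u _ => isClosed_Iic
  have hsub : Icc 0 b ⊆ s := by
    -- To pass beyond `t`: the left germ gives value and left slope zero, the absence of a break
    -- carries this to the right slope, and the right germ then vanishes.
    refine (hclosed.inter isClosed_Icc).Icc_subset_of_forall_mem_nhdsWithin
      (fun u hu hu0 => absurd hu (not_le.2 hu0)) fun t ht => ?_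
    have hts : t ∈ s := ht.1
    have hK : K t = 0 ∧ r t = 0 := by
      rcases ht.2.1.eq_or_lt with h | h
      · rw [← h]; exact ⟨h0, hr0⟩
      · obtain ⟨h1, h2⟩ := hleft t h ht.2.2.le hts
        exact ⟨h1, (hrl t ⟨h, ht.2.2⟩).trans h2⟩
    have hg := hr t ht.2.1 ht.2.2
    rw [RightGerm, hK.1, hK.2] at hg
    obtain ⟨c, hc, hcs⟩ := mem_nhdsGT_iff_exists_Ioo_subset.1 hg
    filter_upwards [Ioo_mem_nhdsGT hc] with v hv u hu huv
    rcases lt_trichotomy u t with h | h | h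
    · exact hts u hu h
    · rw [h, hK.1]
    · simpa using hcs ⟨h, huv.trans hv.2⟩
  refine ⟨fun t ht => ?_, (hleft b hb le_rfl (hsub ⟨hb.le, le_rfl⟩)).2⟩
  rcases ht.1.eq_or_lt with h | h
  · rw [← h, h0]
  · exact (hleft t h ht.2 (hsub ht)).1

theorem max_sub_rightGerm (u t : ℝ) :
    RightGerm (fun s => max (s - u) 0) t (if u ≤ t then 1 else 0) := by
  split_ifs with h
  · filter_upwards [self_mem_nhdsWithin] with s hs
    have : t < s := hs
    rw [max_eq_left (by linarith), max_eq_left (by linarith)]; ring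
  · filter_upwards [Ioo_mem_nhdsGT (not_le.1 h)] with s hs
    rw [max_eq_right (by linarith [hs.2]), max_eq_right (by linarith [not_le.1 h])]; ring

theorem max_sub_leftGerm (u t : ℝ) :
    LeftGerm (fun s => max (s - u) 0) t (if u < t then 1 else 0) := by
  split_ifs with h
  · filter_upwards [Ioo_mem_nhdsLT h] with s hs
    rw [max_eq_left (by linarith [hs.1]), max_eq_left (by linarith)]; ring
  · filter_upwards [self_mem_nhdsWithin] with s hs
    have : s < t := hs
    rw [max_eq_right (by linarith), max_eq_right (by linarith)]; ring

/-! ### Piecewise linear functions on an edge with prescribed slope changes. -/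

namespace MetricGraph

variable {V E : Type*} {Γ : MetricGraph V E}

theorem point_zero (e : E) : Γ.point e 0 = .vertex (Γ.tail e) := by
  simp [point]

theorem point_length (e : E) : Γ.point e (Γ.length e) = .vertex (Γ.head e) := by
  simp [point, Γ.length_pos e]

theorem point_interior (e : E) {t : ℝ} (ht : t ∈ Ioo 0 (Γ.length e)) :
    Γ.point e t = .interior e t ht := by
  simp only [point, dif_pos ht]

theorem exists_rightGerm {f : Γ.Point → ℝ} (hf : f ∈ Γ.PLZ) (e : E) {t : ℝ}
    (h0 : 0 ≤ t) (h1 : t < Γ.length e) :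
    ∃ m : ℤ, RightGerm (fun s => f (Γ.point e s)) t m := by
  obtain ⟨S, hS⟩ := hf
  -- The point `t` is removed from the finite set of breaks because the germ is one-sided and may
  -- start at a break.
  have hev : ∀ᶠ s in 𝓝 t, s ∉ {s | s ∈ Ioo 0 (Γ.length e) ∧ Γ.point e s ∈ S} \ {t} :=
    ((finite_param S e).subset sdiff_subset).isClosed.compl_mem_nhds (by simp)
  obtain ⟨b, hb, hbs⟩ := mem_nhdsGT_iff_exists_Ioo_subset.1
    (nhdsWithin_le_nhds (s := Ioi t) hev)
  have hb : t < b := hb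
  have htb : t < min (Γ.length e) b := lt_min h1 hb
  obtain ⟨m, hm⟩ := hS e t _ h0 htb.le (min_le_left _ _) fun s hs hsS =>
    hbs ⟨hs.1, hs.2.trans_le (min_le_right _ _)⟩
      ⟨⟨⟨h0.trans_lt hs.1, hs.2.trans_le (min_le_left _ _)⟩, hsS⟩, hs.1.ne'⟩
  refine ⟨m, ?_⟩
  filter_upwards [Ioo_mem_nhdsGT htb] with s hs using hm s ⟨hs.1.le, hs.2.le⟩

theorem exists_leftGerm {f : Γ.Point → ℝ} (hf : f ∈ Γ.PLZ) (e : E) {t : ℝ}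
    (h0 : 0 < t) (h1 : t ≤ Γ.length e) :
    ∃ m : ℤ, LeftGerm (fun s => f (Γ.point e s)) t m := by
  obtain ⟨S, hS⟩ := hf
  have hev : ∀ᶠ s in 𝓝 t, s ∉ {s | s ∈ Ioo 0 (Γ.length e) ∧ Γ.point e s ∈ S} \ {t} :=
    ((finite_param S e).subset sdiff_subset).isClosed.compl_mem_nhds (by simp)
  obtain ⟨a, ha, has⟩ := mem_nhdsLT_iff_exists_Ioo_subset.1
    (nhdsWithin_le_nhds (s := Iio t) hev)
  have ha : a < t := ha
  have hat : max 0 a < t := max_lt h0 ha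
  obtain ⟨m, hm⟩ := hS e _ t (le_max_left _ _) hat.le h1 fun s hs hsS =>
    has ⟨(le_max_right _ _).trans_lt hs.1, hs.2⟩
      ⟨⟨⟨(le_max_left _ _).trans_lt hs.1, hs.2.trans_le h1⟩, hsS⟩, hs.2.ne⟩
  refine ⟨m, ?_⟩
  filter_upwards [Ioo_mem_nhdsLT hat] with s hs
  have h2 := hm s ⟨hs.1.le, hs.2.le⟩
  have h3 := hm t ⟨hat.le, le_rfl⟩
  rw [h2, h3]; ring

open Classical in
/-- The function `w` of the parameter on the interior of the edge `e`, extended by zero. -/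
noncomputable def edgeWeight (e : E) (w : ℝ → ℝ) : Γ.Point → ℝ
  | .vertex _ => 0
  | .interior e' u _ => if e' = e then w u else 0

/-- The sum of `w` over the part of the divisor `D` in the interior of the edge `e`. -/
noncomputable def edgeSum (D : Γ.Point →₀ ℤ) (e : E) (w : ℝ → ℝ) : ℝ :=
  D.sum fun p n => (n : ℝ) * edgeWeight e w p

theorem edgeSum_add (D D' : Γ.Point →₀ ℤ) (e : E) (w : ℝ → ℝ) :
    edgeSum (D + D') e w = edgeSum D e w + edgeSum D' e w :=
  Finsupp.sum_add_index' (by simp) (by intros; push_cast; ring)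

theorem edgeSum_single (p : Γ.Point) (n : ℤ) (e : E) (w : ℝ → ℝ) :
    edgeSum (Finsupp.single p n) e w = n * edgeWeight e w p := by
  simp [edgeSum]

theorem edgeSum_zero (e : E) (w : ℝ → ℝ) : edgeSum (0 : Γ.Point →₀ ℤ) e w = 0 := by
  simp [edgeSum]

theorem edgeWeight_congr {e : E} {w w' : ℝ → ℝ} (h : ∀ u ∈ Ioo 0 (Γ.length e), w u = w' u)
    (p : Γ.Point) : edgeWeight e w p = edgeWeight e w' p := by
  cases p with
  | vertex v => rfl
  | interior e' u hu =>
    simp only [edgeWeight]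
    split_ifs with he
    · subst he; exact h u hu
    · rfl

theorem edgeSum_congr (D : Γ.Point →₀ ℤ) {e : E} {w w' : ℝ → ℝ}
    (h : ∀ u ∈ Ioo 0 (Γ.length e), w u = w' u) : edgeSum D e w = edgeSum D e w' := by
  simp only [edgeSum, edgeWeight_congr h]

theorem edgeSum_sub (D : Γ.Point →₀ ℤ) (e : E) (w w' : ℝ → ℝ) :
    edgeSum D e (fun u => w u - w' u) = edgeSum D e w - edgeSum D e w' := by
  simp only [edgeSum, Finsupp.sum, ← Finset.sum_sub_distrib]
  refine Finset.sum_congr rfl fun p _ => ?_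
  cases p with
  | vertex v => simp [edgeWeight]
  | interior e' u hu => simp only [edgeWeight]; split_ifs <;> ring

/-- The two indicators differ only at `u = t`. This is how the jump between the left and right
slopes of `edgeFun` reads off the coefficient of `D`. -/
theorem edgeSum_ite_eq (D : Γ.Point →₀ ℤ) (e : E) {t : ℝ} (ht : t ∈ Ioo 0 (Γ.length e)) :
    edgeSum D e (fun u => (if u ≤ t then 1 else 0) - (if u < t then 1 else 0))
      = D (.interior e t ht) := by
  classical
  induction D using Finsupp.induction_linear with
  | zero => simp [edgeSum_zero]
  | add D D' h h' => rw [edgeSum_add, h, h']; simp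
  | single p n =>
    rw [edgeSum_single, Finsupp.single_apply]
    cases p with
    | vertex v => simp [edgeWeight]
    | interior e' u hu =>
      by_cases he : e' = e
      · subst he
        rcases lt_trichotomy u t with h | h | h
        · simp [edgeWeight, h.le, h, h.ne]
        · simp [edgeWeight, h]
        · simp [edgeWeight, h.not_ge, h.not_gt, h.ne']
      · simp [edgeWeight, he]

theorem edgeSum_rightGerm (D : Γ.Point →₀ ℤ) (e : E) (t : ℝ) :
    RightGerm (fun s => edgeSum D e fun u => max (s - u) 0) t
      (edgeSum D e fun u => if u ≤ t then 1 else 0) := by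
  have : ∀ᶠ s in 𝓝[>] t, ∀ p ∈ D.support, edgeWeight e (fun u => max (s - u) 0) p =
      edgeWeight e (fun u => max (t - u) 0) p +
        edgeWeight e (fun u => if u ≤ t then 1 else 0) p * (s - t) := by
    rw [eventually_all_finset]
    intro p _
    cases p with
    | vertex v => simp [edgeWeight]
    | interior e' u hu =>
      by_cases he : e' = e
      · simp only [edgeWeight, if_pos he]
        exact max_sub_rightGerm u t
      · simp [edgeWeight, he]
  filter_upwards [this] with s hs
  simp only [edgeSum, Finsupp.sum, Finset.sum_mul, ← Finset.sum_add_distrib]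
  refine Finset.sum_congr rfl fun p hp => ?_
  rw [hs p hp]; ring

theorem edgeSum_leftGerm (D : Γ.Point →₀ ℤ) (e : E) (t : ℝ) :
    LeftGerm (fun s => edgeSum D e fun u => max (s - u) 0) t
      (edgeSum D e fun u => if u < t then 1 else 0) := by
  have : ∀ᶠ s in 𝓝[<] t, ∀ p ∈ D.support, edgeWeight e (fun u => max (s - u) 0) p =
      edgeWeight e (fun u => max (t - u) 0) p +
        edgeWeight e (fun u => if u < t then 1 else 0) p * (s - t) := by
    rw [eventually_all_finset]
    intro p _
    cases p with
    | vertex v => simp [edgeWeight]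
    | interior e' u hu =>
      by_cases he : e' = e
      · simp only [edgeWeight, if_pos he]
        exact max_sub_leftGerm u t
      · simp [edgeWeight, he]
  filter_upwards [this] with s hs
  simp only [edgeSum, Finsupp.sum, Finset.sum_mul, ← Finset.sum_add_distrib]
  refine Finset.sum_congr rfl fun p hp => ?_
  rw [hs p hp]; ring

/-- The piecewise linear function on the edge `e` with initial value `c`, initial slope `m`,
and slope changes given by `D`. -/
noncomputable def edgeFun (D : Γ.Point →₀ ℤ) (e : E) (c m : ℝ) (t : ℝ) : ℝ :=
  c + m * t - edgeSum D e fun u => max (t - u) 0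

theorem edgeFun_rightGerm (D : Γ.Point →₀ ℤ) (e : E) (c m t : ℝ) :
    RightGerm (edgeFun D e c m) t (m - edgeSum D e fun u => if u ≤ t then 1 else 0) :=
  RightGerm.sub (.of_forall fun s => by ring) (edgeSum_rightGerm D e t)

theorem edgeFun_leftGerm (D : Γ.Point →₀ ℤ) (e : E) (c m t : ℝ) :
    LeftGerm (edgeFun D e c m) t (m - edgeSum D e fun u => if u < t then 1 else 0) :=
  LeftGerm.sub (.of_forall fun s => by ring) (edgeSum_leftGerm D e t)

theorem edgeFun_zero (D : Γ.Point →₀ ℤ) (e : E) (c m : ℝ) : edgeFun D e c m 0 = c := by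
  -- The zero weight is written as `0 - 0` so that `edgeSum_sub` makes the sum cancel.
  have : edgeSum D e (fun u => max (0 - u) 0) = edgeSum D e (fun u => (0 : ℝ) - 0) :=
    edgeSum_congr D fun u hu => by rw [max_eq_right (by linarith [hu.1]), sub_zero]
  rw [edgeFun, this, edgeSum_sub]; ring

theorem edgeFun_length (D : Γ.Point →₀ ℤ) (e : E) (c m : ℝ) :
    edgeFun D e c m (Γ.length e) =
      c + m * Γ.length e - edgeSum D e fun u => Γ.length e - u := by
  rw [edgeFun, edgeSum_congr D fun u hu => max_eq_left (by linarith [hu.2])]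

theorem edgeSum_ite_le_zero (D : Γ.Point →₀ ℤ) (e : E) :
    (edgeSum D e fun u => if u ≤ 0 then 1 else 0) = 0 := by
  have : edgeSum D e (fun u => if u ≤ 0 then 1 else 0) = edgeSum D e (fun u => (0 : ℝ) - 0) :=
    edgeSum_congr D fun u hu => by rw [if_neg (not_le.2 hu.1), sub_zero]
  rw [this, edgeSum_sub, sub_self]

theorem edgeSum_ite_lt_length (D : Γ.Point →₀ ℤ) (e : E) :
    (edgeSum D e fun u => if u < Γ.length e then 1 else 0) = edgeSum D e fun _ => 1 :=
  edgeSum_congr D fun _ hu => if_pos hu.2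

/-- The function with vertex values `h`, initial slopes `σ`, and slope changes given by `D`. -/
noncomputable def glue (D : Γ.Point →₀ ℤ) (h : V → ℝ) (σ : E → ℤ) : Γ.Point → ℝ
  | .vertex v => h v
  | .interior e t _ => edgeFun D e (h (Γ.tail e)) (σ e) t

/-- The hypothesis is the matching condition at the far end: starting from the value at the tail,
the edge function arrives at the prescribed value at the head. -/
theorem glue_point {D : Γ.Point →₀ ℤ} {h : V → ℝ} {σ : E → ℤ} {e : E}
    (hh : h (Γ.head e) - h (Γ.tail e) =
      σ e * Γ.length e - edgeSum D e fun u => Γ.length e - u) :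
    ∀ t ∈ Icc 0 (Γ.length e),
      edgeFun D e (h (Γ.tail e)) (σ e) t = glue D h σ (Γ.point e t) := by
  intro t ht
  rcases ht.1.eq_or_lt with h0 | h0
  · rw [← h0, edgeFun_zero, point_zero]; rfl
  rcases ht.2.eq_or_lt with h1 | h1
  · rw [h1, edgeFun_length, point_length]
    change _ = h (Γ.head e)
    linarith
  · rw [point_interior e ⟨h0, h1⟩]; rfl

theorem edgeFun_affine (D : Γ.Point →₀ ℤ) (e : E) (c : ℝ) (m : ℤ) {a b : ℝ}
    (hb : b ≤ Γ.length e)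
    (hD : ∀ t ∈ Ioo a b, Γ.point e t ∉ D.support) :
    ∃ k : ℤ, ∀ t ∈ Icc a b, edgeFun D e c m t = edgeFun D e c m a + k * (t - a) := by
  -- No point of `D` lies inside the segment, so each hinge `max (t - u) 0` has slope `0` or `1`
  -- throughout it.
  have key : ∀ p ∈ D.support, ∃ k : ℤ, ∀ t ∈ Icc a b,
      edgeWeight e (fun u => max (t - u) 0) p =
        edgeWeight e (fun u => max (a - u) 0) p + k * (t - a) := by
    intro p hp
    cases p with
    | vertex v => exact ⟨0, fun t _ => by simp [edgeWeight]⟩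
    | interior e' u hu =>
      by_cases he : e' = e
      · subst he
        simp only [edgeWeight, if_true]
        by_cases hua : u ≤ a
        · refine ⟨1, fun t ht => ?_⟩
          rw [max_eq_left (by linarith [ht.1]), max_eq_left (by linarith)]
          push_cast; ring
        · have hub : b ≤ u := by
            by_contra! hub
            exact hD u ⟨not_le.1 hua, hub⟩ (by rwa [point_interior _ hu])
          refine ⟨0, fun t ht => ?_⟩
          rw [max_eq_right (by linarith [ht.2]), max_eq_right (by linarith)]
          push_cast; ring
      · exact ⟨0, fun t _ => by simp [edgeWeight, he]⟩
  choose! k hk using key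
  refine ⟨m - ∑ p ∈ D.support, D p * k p, fun t ht => ?_⟩
  have : edgeSum D e (fun u => max (t - u) 0) = edgeSum D e (fun u => max (a - u) 0) +
      (∑ p ∈ D.support, (D p : ℝ) * k p) * (t - a) := by
    simp only [edgeSum, Finsupp.sum, Finset.sum_mul, ← Finset.sum_add_distrib]
    refine Finset.sum_congr rfl fun p hp => ?_
    rw [hk p hp t ht]; ring
  rw [edgeFun, edgeFun, this]
  push_cast
  ring

theorem glue_mem_PLZ {D : Γ.Point →₀ ℤ} {h : V → ℝ} {σ : E → ℤ}
    (hh : ∀ e, h (Γ.head e) - h (Γ.tail e) =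
      σ e * Γ.length e - edgeSum D e fun u => Γ.length e - u) : glue D h σ ∈ Γ.PLZ := by
  refine ⟨D.support, fun e a b ha hab hb hS => ?_⟩
  obtain ⟨k, hk⟩ := edgeFun_affine D e (h (Γ.tail e)) (σ e) hb hS
  refine ⟨k, fun t ht => ?_⟩
  rw [← glue_point (hh e) t ⟨ha.trans ht.1, ht.2.trans hb⟩, ← glue_point (hh e) a
    ⟨ha, hab.trans hb⟩, hk t ht]

/-! ### Divisors of piecewise linear functions, edge by edge. -/

section Laplacian

variable [Fintype E] [DecidableEq V]

/-- A piecewise `ℤ`-linear function is determined on an edge by its divisor, its initial value and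
its initial slope. -/
theorem eq_edgeFun {f : Γ.Point → ℝ} (hf : f ∈ Γ.PLZ) {D : Γ.Point →₀ ℤ}
    (hD : ∀ p, (D p : ℝ) = Γ.laplacian f p) (e : E) :
    (∀ t ∈ Icc 0 (Γ.length e),
      f (Γ.point e t) = edgeFun D e (f (.vertex (Γ.tail e))) (Γ.slopeRight f e 0) t) ∧
    Γ.slopeLeft f e (Γ.length e) = -(Γ.slopeRight f e 0 - edgeSum D e fun _ => 1) := by
  set c := f (.vertex (Γ.tail e))
  set m := Γ.slopeRight f e 0
  have hr : ∀ t, 0 ≤ t → t < Γ.length e →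
      RightGerm (fun s => f (Γ.point e s)) t (Γ.slopeRight f e t) := fun t h0 h1 => by
    obtain ⟨k, hk⟩ := exists_rightGerm hf e h0 h1
    rw [slopeRight, hk.derivWithin_eq]; exact hk
  have hl : ∀ t, 0 < t → t ≤ Γ.length e →
      LeftGerm (fun s => f (Γ.point e s)) t (-Γ.slopeLeft f e t) := fun t h0 h1 => by
    obtain ⟨k, hk⟩ := exists_leftGerm hf e h0 h1
    rw [slopeLeft, hk.derivWithin_eq, neg_neg]; exact hk
  obtain ⟨h1, h2⟩ := eq_zero_of_germs (Γ.length_pos e)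
    (fun t h0 h1 => (hr t h0 h1).sub (edgeFun_rightGerm D e c m t))
    (fun t h0 h1 => (hl t h0 h1).sub (edgeFun_leftGerm D e c m t))
    (fun t ht => by
      have h1 := hD (.interior e t ht)
      rw [← edgeSum_ite_eq D e ht, edgeSum_sub] at h1
      simp only [laplacian] at h1
      linarith)
    (by simp only [edgeFun_zero, point_zero]; exact sub_self _)
    (by rw [edgeSum_ite_le_zero]; ring)
  refine ⟨fun t ht => sub_eq_zero.1 (h1 t ht), ?_⟩
  rw [edgeSum_ite_lt_length] at h2
  linarith

/-- Interior coefficients come out right by construction of `edgeFun`; `hσ` is the remaining balance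
of outgoing slopes at each vertex. -/
theorem laplacian_glue {D : Γ.Point →₀ ℤ} {h : V → ℝ} {σ : E → ℤ}
    (hh : ∀ e, h (Γ.head e) - h (Γ.tail e) =
      σ e * Γ.length e - edgeSum D e fun u => Γ.length e - u)
    (hσ : ∀ v, (D (.vertex v) : ℝ) = -∑ e, ((if Γ.tail e = v then (σ e : ℝ) else 0) +
      if Γ.head e = v then -(σ e - edgeSum D e fun _ => 1) else 0)) (p : Γ.Point) :
    (D p : ℝ) = Γ.laplacian (glue D h σ) p := by
  have hr : ∀ e t, 0 ≤ t → t < Γ.length e → Γ.slopeRight (glue D h σ) e t =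
      σ e - edgeSum D e fun u => if u ≤ t then 1 else 0 := fun e t h0 h1 =>
    ((edgeFun_rightGerm D e _ _ t).congr (glue_point (hh e)) h0 h1).derivWithin_eq
  have hl : ∀ e t, 0 < t → t ≤ Γ.length e → Γ.slopeLeft (glue D h σ) e t =
      -(σ e - edgeSum D e fun u => if u < t then 1 else 0) := fun e t h0 h1 =>
    congrArg Neg.neg
      ((edgeFun_leftGerm D e _ _ t).congr (glue_point (hh e)) h0 h1).derivWithin_eq
  cases p with
  | vertex v =>
    simp only [laplacian, hr _ 0 le_rfl (Γ.length_pos _), hl _ _ (Γ.length_pos _) le_rfl,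
      edgeSum_ite_le_zero, edgeSum_ite_lt_length, sub_zero, hσ]
  | interior e t ht =>
    simp only [laplacian, hr e t ht.1.le ht.2, hl e t ht.1 ht.2.le]
    rw [← edgeSum_ite_eq D e ht, edgeSum_sub]
    ring

end Laplacian

end MetricGraph

/-! ### Periods and Abel's theorem. -/

namespace MetricGraph

variable {V E : Type*} (Γ : MetricGraph V E) [Fintype E] [DecidableEq V]

/-- The space `H₁(Γ, ℝ)` of cycles. -/
noncomputable abbrev cycles : Submodule ℝ (E → ℝ) := LinearMap.ker Γ.boundary

/-- The functional on `H₁(Γ, ℝ)` that reads off the coefficient of the edge `e`. -/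
noncomputable def edgeForm (e : E) : Module.Dual ℝ Γ.cycles :=
  (LinearMap.proj e).comp Γ.cycles.subtype

/-- An integer `0`-chain together with a functional on `H₁(Γ, ℝ)`. -/
abbrev Period : Type _ := (V → ℤ) × Module.Dual ℝ Γ.cycles

/-- The period of an edge: its boundary, together with integration along it. -/
noncomputable def edgePeriod (e : E) : Γ.Period :=
  (Pi.single (Γ.head e) 1 - Pi.single (Γ.tail e) 1, Γ.length e • Γ.edgeForm e)

/-- The periods of integer `1`-chains. -/
noncomputable def chainPeriod : (E → ℤ) →+ Γ.Period :=
  ∑ e, ((zmultiplesHom Γ.Period) (Γ.edgePeriod e)).comp (Pi.evalAddMonoidHom _ e)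

/-- A point on an edge is represented by the head of the edge, together with integration from the
point to the head. -/
noncomputable def pointPeriod : Γ.Point → Γ.Period
  | .vertex v => (Pi.single v 1, 0)
  | .interior e t _ => (Pi.single (Γ.head e) 1, (Γ.length e - t) • Γ.edgeForm e)

/-- The additive extension of `pointPeriod` to divisors. -/
noncomputable def divisorPeriod : Γ.Divisor →+ Γ.Period :=
  Finsupp.liftAddHom fun p => zmultiplesHom _ (Γ.pointPeriod p)

variable {Γ}

theorem edgeForm_apply (e : E) (ω : Γ.cycles) : Γ.edgeForm e ω = ω.1 e := rfl

theorem boundary_apply (ω : E → ℝ) (v : V) : Γ.boundary ω v =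
    ∑ e, ω e * ((if Γ.head e = v then 1 else 0) - if Γ.tail e = v then 1 else 0) := by
  simp [boundary, Pi.single_apply, eq_comm]

theorem chainPeriod_apply (σ : E → ℤ) : Γ.chainPeriod σ = ∑ e, σ e • Γ.edgePeriod e := by
  simp [chainPeriod]

theorem chainPeriod_fst (σ : E → ℤ) (v : V) : (Γ.chainPeriod σ).1 v =
    ∑ e, σ e * ((if Γ.head e = v then 1 else 0) - if Γ.tail e = v then 1 else 0) := by
  simp [chainPeriod_apply, edgePeriod, Prod.fst_sum, Pi.single_apply, eq_comm]

theorem chainPeriod_snd (σ : E → ℤ) (ω : Γ.cycles) :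
    (Γ.chainPeriod σ).2 ω = ∑ e, σ e * (Γ.length e * ω.1 e) := by
  simp [chainPeriod_apply, edgePeriod, Prod.snd_sum, edgeForm_apply, mul_left_comm]

theorem divisorPeriod_single (p : Γ.Point) (n : ℤ) :
    Γ.divisorPeriod (Finsupp.single p n) = n • Γ.pointPeriod p := by
  simp [divisorPeriod]

/-- Interior points are moved to the head of their edge, which explains the second term. -/
theorem divisorPeriod_fst (D : Γ.Divisor) (v : V) : ((Γ.divisorPeriod D).1 v : ℝ) =
    D (.vertex v) + ∑ e, if Γ.head e = v then edgeSum D e fun _ => 1 else 0 := by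
  induction D using Finsupp.induction_linear with
  | zero => simp [edgeSum_zero]
  | add D D' h h' =>
    rw [map_add, Prod.fst_add, Pi.add_apply, Int.cast_add, h, h', Finsupp.add_apply]
    simp only [edgeSum_add, ← Finset.sum_filter, Finset.sum_add_distrib]
    push_cast
    ring
  | single p n =>
    classical
    rw [divisorPeriod_single]
    simp only [edgeSum_single]
    cases p with
    | vertex w => simp [pointPeriod, edgeWeight, Pi.single_apply, Finsupp.single_apply, eq_comm]
    | interior e t ht =>
      rw [Finset.sum_eq_single e (fun e' _ he' => by simp [edgeWeight, he'.symm]) (by simp)]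
      simp [pointPeriod, edgeWeight, Pi.single_apply, eq_comm]

theorem divisorPeriod_snd (D : Γ.Divisor) (ω : Γ.cycles) : (Γ.divisorPeriod D).2 ω =
    ∑ e, ω.1 e * edgeSum D e fun u => Γ.length e - u := by
  induction D using Finsupp.induction_linear with
  | zero => simp [edgeSum_zero]
  | add D D' h h' =>
    rw [map_add, Prod.snd_add, LinearMap.add_apply, h, h', ← Finset.sum_add_distrib]
    simp only [edgeSum_add, mul_add]
  | single p n =>
    classical
    rw [divisorPeriod_single]
    simp only [edgeSum_single]
    cases p with
    | vertex w => simp [pointPeriod, edgeWeight]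
    | interior e t ht =>
      rw [Finset.sum_eq_single e (fun e' _ he' => by simp [edgeWeight, he'.symm]) (by simp)]
      simp [pointPeriod, edgeWeight, edgeForm_apply]
      ring

/-- The edge functions that vanish on cycles are the coboundaries. -/
theorem exists_potential {w : E → ℝ} (hw : ∀ ω : Γ.cycles, ∑ e, ω.1 e * w e = 0) :
    ∃ h : V → ℝ, ∀ e, h (Γ.head e) - h (Γ.tail e) = w e := by
  classical
  let W : Module.Dual ℝ (E → ℝ) := Fintype.linearCombination ℝ w
  have hW : W ∈ (LinearMap.ker Γ.boundary).dualAnnihilator := by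
    rw [Submodule.mem_dualAnnihilator]
    intro ω hω
    simpa [W, Fintype.linearCombination_apply] using hw ⟨ω, hω⟩
  -- A functional that kills the kernel of the boundary map factors through that map; the factor,
  -- evaluated on the vertices, is the potential.
  rw [← LinearMap.range_dualMap_eq_dualAnnihilator_ker] at hW
  obtain ⟨g, hg⟩ := hW
  refine ⟨fun v => g (Pi.single v 1), fun e => ?_⟩
  have h1 : g (Γ.boundary (Pi.single e 1)) = W (Pi.single e 1) := congrArg (· (Pi.single e 1)) hg
  have h2 : Γ.boundary (Pi.single e 1) = Pi.single (Γ.head e) 1 - Pi.single (Γ.tail e) 1 := by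
    simp [boundary, Pi.single_apply]
  rw [h2, map_sub] at h1
  simpa [W] using h1

/-- Summation by parts: the sum pairs `h` with the boundary of `ω`, which is zero. -/
theorem sum_potential [Fintype V] (h : V → ℝ) (ω : Γ.cycles) :
    ∑ e, ω.1 e * (h (Γ.head e) - h (Γ.tail e)) = 0 := by
  have h0 : ∑ v, h v * Γ.boundary ω.1 v = 0 := by
    rw [LinearMap.mem_ker.1 ω.2]; simp
  rw [← h0]
  simp only [boundary_apply, Finset.mul_sum]
  rw [Finset.sum_comm]
  refine Finset.sum_congr rfl fun e _ => ?_
  simp_rw [mul_left_comm (h _), ← Finset.mul_sum, mul_sub, Finset.sum_sub_distrib]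
  simp [mul_sub]

/-- **Abel's theorem** for metric graphs. -/
theorem mem_principal_iff [Fintype V] (D : Γ.Divisor) :
    D ∈ Γ.principal ↔ ∃ σ, Γ.chainPeriod σ = Γ.divisorPeriod D := by
  have hσ_iff : ∀ (σ : E → ℤ) (v : V), (Γ.chainPeriod σ).1 v = (Γ.divisorPeriod D).1 v ↔
      (D (.vertex v) : ℝ) = -∑ e, ((if Γ.tail e = v then (σ e : ℝ) else 0) +
        if Γ.head e = v then -(σ e - edgeSum D e fun _ => 1) else 0) := by
    intro σ v
    rw [← Int.cast_inj (α := ℝ), divisorPeriod_fst, chainPeriod_fst, ← sub_eq_iff_eq_add, eq_comm]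
    push_cast
    rw [← Finset.sum_sub_distrib, ← Finset.sum_neg_distrib]
    refine Eq.congr_right (Finset.sum_congr rfl fun e _ => ?_)
    split_ifs <;> ring
  constructor
  · rintro ⟨f, hf, hD⟩
    -- The required chain consists of the initial slopes of `f`; the vertex values of `f` cancel
    -- against every cycle.
    choose σ hσ using fun e => exists_rightGerm hf e le_rfl (Γ.length_pos e)
    have hs : ∀ e, Γ.slopeRight f e 0 = σ e := fun e => (hσ e).derivWithin_eq
    refine ⟨σ, Prod.ext (funext fun v => (hσ_iff σ v).2 ?_) (LinearMap.ext fun ω => ?_)⟩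
    · simp only [hD, laplacian, (eq_edgeFun hf hD _).2, hs]
    · rw [chainPeriod_snd, divisorPeriod_snd, ← sub_eq_zero, ← Finset.sum_sub_distrib,
        ← sum_potential (fun v => f (.vertex v)) ω]
      refine Finset.sum_congr rfl fun e _ => ?_
      have h1 := (eq_edgeFun hf hD e).1 _ ⟨(Γ.length_pos e).le, le_rfl⟩
      rw [edgeFun_length, point_length, hs] at h1
      rw [h1]; ring
  · rintro ⟨σ, hσ⟩
    -- Conversely, read `σ` as initial slopes. They prescribe an increment along each edge, and
    -- equality of the functionals says that these increments come from vertex values.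
    obtain ⟨h, hh⟩ := exists_potential (Γ := Γ)
      (w := fun e => σ e * Γ.length e - edgeSum D e fun u => Γ.length e - u) fun ω => by
        have h1 := congrArg (fun P : Γ.Period => P.2 ω) hσ
        rw [chainPeriod_snd, divisorPeriod_snd, ← sub_eq_zero, ← Finset.sum_sub_distrib] at h1
        rw [← h1]
        exact Finset.sum_congr rfl fun e _ => by ring
    exact ⟨glue D h σ, glue_mem_PLZ hh,
      laplacian_glue hh fun v => (hσ_iff σ v).1 (by rw [hσ])⟩

end MetricGraph

/-! ### The Jacobian inside the period quotient, and torsion along an edge. -/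

namespace MetricGraph

variable {V E : Type*} (Γ : MetricGraph V E) [Fintype E] [DecidableEq V]

/-- Periods modulo the periods of integer chains; the Jacobian embeds into this group. -/
def PeriodQuotient : Type _ := Γ.Period ⧸ Γ.chainPeriod.range

noncomputable instance : AddCommGroup Γ.PeriodQuotient :=
  inferInstanceAs (AddCommGroup (Γ.Period ⧸ Γ.chainPeriod.range))

/-- The quotient map. -/
noncomputable def periodMk : Γ.Period →+ Γ.PeriodQuotient :=
  QuotientAddGroup.mk' Γ.chainPeriod.range

/-- The class of a point. -/
noncomputable def pointClass (x : Γ.Point) : Γ.PeriodQuotient :=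
  Γ.periodMk (Γ.pointPeriod x)

/-- The class of a functional on `H₁(Γ, ℝ)`. -/
noncomputable def formClass : Module.Dual ℝ Γ.cycles →+ Γ.PeriodQuotient :=
  Γ.periodMk.comp (AddMonoidHom.inr _ _)

variable {Γ}

theorem periodMk_eq_zero {P : Γ.Period} : Γ.periodMk P = 0 ↔ ∃ σ, Γ.chainPeriod σ = P :=
  QuotientAddGroup.eq_zero_iff P

theorem formClass_apply (φ : Module.Dual ℝ Γ.cycles) : Γ.formClass φ = Γ.periodMk (0, φ) := rfl

theorem formClass_sub_smul (a b : ℝ) (φ : Module.Dual ℝ Γ.cycles) :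
    Γ.formClass ((a - b) • φ) = Γ.formClass (a • φ) - Γ.formClass (b • φ) :=
  (congrArg _ (sub_smul a b φ)).trans (map_sub _ _ _)

theorem periodMk_divisorPeriod [Fintype V] (D : Γ.Divisor) :
    Γ.periodMk (Γ.divisorPeriod D) = 0 ↔ D ∈ Γ.principal := by
  rw [periodMk_eq_zero, mem_principal_iff]

variable (Γ) in
/-- The embedding of the Jacobian induced by `divisorPeriod`. -/
noncomputable def jacPeriod [Fintype V] : Γ.Jac →+ Γ.PeriodQuotient :=
  QuotientAddGroup.lift _ ((Γ.periodMk.comp Γ.divisorPeriod).comp Γ.DivisorZero.subtype)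
    fun D hD => (periodMk_divisorPeriod D.1).2 hD

theorem jacPeriod_injective [Fintype V] : Function.Injective Γ.jacPeriod := by
  rw [injective_iff_map_eq_zero]
  intro c hc
  induction c using QuotientAddGroup.induction_on with
  | H D => exact (QuotientAddGroup.eq_zero_iff D).2 ((periodMk_divisorPeriod D.1).1 hc)

theorem jacPeriod_abelJacobi [Fintype V] (q x : Γ.Point) :
    Γ.jacPeriod (Γ.abelJacobi q x) = Γ.pointClass x - Γ.pointClass q := by
  change Γ.periodMk (Γ.divisorPeriod (Finsupp.single x 1 - Finsupp.single q 1)) = _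
  simp only [map_sub, divisorPeriod_single, one_smul, pointClass]

theorem periodMk_edgePeriod (e : E) : Γ.periodMk (Γ.edgePeriod e) = 0 := by
  classical
  exact periodMk_eq_zero.2 ⟨Pi.single e 1, by simp [chainPeriod_apply, Pi.single_apply]⟩

/-- Subtracting the period of the whole edge, which is zero in the quotient, replaces integration to
the head by integration from the tail with the opposite sign. -/
theorem pointClass_point (e : E) {t : ℝ} (ht : t ∈ Icc 0 (Γ.length e)) :
    Γ.pointClass (Γ.point e t) =
      Γ.pointClass (.vertex (Γ.tail e)) - Γ.formClass (t • Γ.edgeForm e) := by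
  rcases ht.1.eq_or_lt with h0 | h0
  · rw [← h0, point_zero]; simp
  have key : ∀ x, Γ.pointPeriod x = (Pi.single (Γ.head e) 1, (Γ.length e - t) • Γ.edgeForm e) →
      Γ.pointClass x =
        Γ.pointClass (.vertex (Γ.tail e)) - Γ.formClass (t • Γ.edgeForm e) := by
    intro x hx
    rw [pointClass, pointClass, hx, formClass_apply, ← sub_eq_zero, ← map_sub, ← map_sub,
      ← periodMk_edgePeriod e]
    congr 1
    ext1
    · simp [pointPeriod, edgePeriod]
    · simp only [pointPeriod, edgePeriod, Prod.snd_sub]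
      module
  rcases ht.2.eq_or_lt with h1 | h1
  · rw [h1, point_length, ← h1]
    exact key _ (by simp [pointPeriod, h1])
  · rw [point_interior e ⟨h0, h1⟩]
    exact key _ rfl

theorem pointClass_head (e : E) : Γ.pointClass (.vertex (Γ.head e)) =
    Γ.pointClass (.vertex (Γ.tail e)) - Γ.formClass (Γ.length e • Γ.edgeForm e) := by
  rw [← pointClass_point e ⟨(Γ.length_pos e).le, le_rfl⟩, point_length]

/-- A chain whose period has zero first component is a cycle. -/
theorem exists_cycle_of_formClass_eq_zero {φ : Module.Dual ℝ Γ.cycles} (h : Γ.formClass φ = 0) :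
    ∃ z : E → ℤ, (fun e => (z e : ℝ)) ∈ Γ.cycles ∧
      ∀ ω : Γ.cycles, φ ω = ∑ e, z e * (Γ.length e * ω.1 e) := by
  obtain ⟨z, hz⟩ := periodMk_eq_zero.1 h
  refine ⟨z, LinearMap.mem_ker.2 (funext fun v => ?_), fun ω => ?_⟩
  · have h1 := congrArg (fun P : Γ.Period => ((P.1 v : ℤ) : ℝ)) hz
    simp only [chainPeriod_fst] at h1
    push_cast at h1
    rw [boundary_apply, h1]; simp
  · rw [← chainPeriod_snd, hz]; rfl

/-- If the class vanished, `d • edgeForm e` would be the length pairing with an integer cycle `z`.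
Evaluated at `z` itself this gives `d * z e = ∑ ℓ z²`, and `d < ℓ e` leaves only `z = 0`, against
`edgeForm e ≠ 0`. -/
theorem formClass_ne_zero {e : E} (he : Γ.edgeForm e ≠ 0) {d : ℝ} (h0 : 0 < d)
    (h1 : d < Γ.length e) : Γ.formClass (d • Γ.edgeForm e) ≠ 0 := by
  intro h
  obtain ⟨z, hz, hφ⟩ := exists_cycle_of_formClass_eq_zero h
  have h2 : d * z e = ∑ e, Γ.length e * (z e : ℝ) ^ 2 := by
    have := hφ ⟨_, hz⟩
    simp only [LinearMap.smul_apply, edgeForm_apply, smul_eq_mul] at this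
    rw [this]
    exact Finset.sum_congr rfl fun e _ => by ring
  have hnn : ∀ e ∈ Finset.univ, 0 ≤ Γ.length e * (z e : ℝ) ^ 2 := fun e _ =>
    mul_nonneg (Γ.length_pos e).le (sq_nonneg _)
  have h3 := Finset.single_le_sum hnn (Finset.mem_univ e)
  rw [← h2] at h3
  by_cases hze : z e = 0
  · rw [hze, Int.cast_zero, mul_zero, eq_comm, Finset.sum_eq_zero_iff_of_nonneg hnn] at h2
    refine he (LinearMap.ext fun ω => ?_)
    have h4 := hφ ω
    rw [Finset.sum_eq_zero fun e' he' => ?_] at h4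
    · simpa [h0.ne'] using h4
    · have := h2 e' he'
      rw [mul_eq_zero, or_iff_right (Γ.length_pos e').ne', sq_eq_zero_iff] at this
      rw [this, zero_mul]
  -- Integrality enters here: `ℓ e * (z e)² ≤ d * z e ≤ d * (z e)² < ℓ e * (z e)²`.
  · have h4 : (z e : ℝ) ≤ (z e : ℝ) ^ 2 := by exact_mod_cast Int.le_self_sq (z e)
    have h5 : 0 < (z e : ℝ) ^ 2 := by positivity
    nlinarith

theorem isOfFinAddOrder_formClass_rat {φ : Module.Dual ℝ Γ.cycles}
    (h : IsOfFinAddOrder (Γ.formClass φ)) (r : ℚ) :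
    IsOfFinAddOrder (Γ.formClass ((r : ℝ) • φ)) := by
  have h1 : r.den • Γ.formClass ((r : ℝ) • φ) = r.num • Γ.formClass φ := by
    rw [← map_nsmul, ← map_zsmul]
    congr 1
    rw [← Nat.cast_smul_eq_nsmul ℝ, ← Int.cast_smul_eq_zsmul ℝ, smul_smul]
    congr 1
    exact_mod_cast Rat.den_mul_eq_num r
  have h2 : IsOfFinAddOrder (r.den • Γ.formClass ((r : ℝ) • φ)) := h1 ▸ h.zsmul
  exact (isOfFinAddOrder_nsmul.1 h2).resolve_right r.den_nz

/-- If two points on an edge that lies on a cycle differ by torsion, then there are infinitely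
many torsion points. -/
theorem infinite_torsion {e : E} (he : Γ.edgeForm e ≠ 0) {L s : ℝ} (hL : 0 < L)
    (hLt : IsOfFinAddOrder (Γ.formClass (L • Γ.edgeForm e))) (hs : s ∈ Icc 0 (Γ.length e))
    {q : Γ.Point} (hsq : IsOfFinAddOrder (Γ.pointClass (Γ.point e s) - Γ.pointClass q)) :
    ((fun x => Γ.pointClass x - Γ.pointClass q) ''
      {x | IsOfFinAddOrder (Γ.pointClass x - Γ.pointClass q)}).Infinite := by
  -- These are the bounds on `r` for which `s + r * L` stays inside the edge.
  have hlt : -s / L < (Γ.length e - s) / L :=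
    div_lt_div_of_pos_right (by linarith [Γ.length_pos e]) hL
  obtain ⟨r₁, h1, h2⟩ := exists_rat_btwn hlt
  obtain ⟨r₂, h3, h4⟩ := exists_rat_btwn h2
  have hmem : ∀ r ∈ Ioo r₁ r₂, s + r * L ∈ Ioo 0 (Γ.length e) := by
    rintro r ⟨hr1, hr2⟩
    have hr1 : (r₁ : ℝ) < r := by exact_mod_cast hr1
    have hr2 : (r : ℝ) < r₂ := by exact_mod_cast hr2
    have h5 := (div_lt_iff₀ hL).1 (h1.trans hr1)
    have h6 := (lt_div_iff₀ hL).1 (hr2.trans h4)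
    constructor <;> linarith
  refine ((Set.Ioo_infinite (by exact_mod_cast h3 : r₁ < r₂)).image
    (f := fun r : ℚ => Γ.pointClass (Γ.point e (s + r * L)) - Γ.pointClass q) ?_).mono ?_
  · have hne : ∀ r ∈ Ioo r₁ r₂, ∀ r' ∈ Ioo r₁ r₂, r < r' →
        Γ.pointClass (Γ.point e (s + r * L)) ≠ Γ.pointClass (Γ.point e (s + r' * L)) := by
      intro r hr r' hr' hlt heq
      have hlt : (r : ℝ) * L < r' * L :=
        mul_lt_mul_of_pos_right (by exact_mod_cast hlt) hL
      rw [pointClass_point e (Ioo_subset_Icc_self (hmem r hr)),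
        pointClass_point e (Ioo_subset_Icc_self (hmem r' hr')), sub_right_inj, eq_comm,
        ← sub_eq_zero, ← formClass_sub_smul] at heq
      exact formClass_ne_zero he (by linarith) (by linarith [(hmem r hr).1, (hmem r' hr').2]) heq
    intro r hr r' hr' heq
    have heq := sub_left_injective heq
    rcases lt_trichotomy r r' with h | h | h
    · exact absurd heq (hne r hr r' hr' h)
    · exact h
    · exact absurd heq.symm (hne r' hr' r hr h)
  · rintro _ ⟨r, hr, rfl⟩
    refine ⟨_, ?_, rfl⟩
    have : Γ.pointClass (Γ.point e (s + r * L)) - Γ.pointClass q =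
        (Γ.pointClass (Γ.point e s) - Γ.pointClass q) -
          Γ.formClass ((r : ℝ) • L • Γ.edgeForm e) := by
      rw [pointClass_point e (Ioo_subset_Icc_self (hmem r hr)), pointClass_point e hs, add_smul,
        map_add, smul_smul]
      abel
    rw [mem_ofPred_eq, this, sub_eq_add_neg]
    exact hsq.add (isOfFinAddOrder_formClass_rat hLt r).neg

end MetricGraph

/-! ### Series classes of edges in a finite multigraph. -/

section Darts

variable {N W : Type*}

/-- The reverse of a dart (an oriented edge). -/
def dartRev (d : N × Bool) : N × Bool := (d.1, !d.2)

theorem dartRev_dartRev (d : N × Bool) : dartRev (dartRev d) = d := by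
  simp [dartRev]

theorem eq_or_eq_dartRev {d d' : N × Bool} (h : d.1 = d'.1) : d' = d ∨ d' = dartRev d := by
  obtain ⟨e, b⟩ := d
  obtain ⟨e', b'⟩ := d'
  obtain rfl : e = e' := h
  cases b <;> cases b' <;> simp [dartRev]

variable [Fintype N] [DecidableEq W] (src : N × Bool → W)

/-- The number of darts that start at `w`. -/
def dartDegree (w : W) : ℕ := (Finset.univ.filter fun d => src d = w).card

/-- `d'` continues `d` through a vertex of degree two. -/
def DartNext (d d' : N × Bool) : Prop :=
  dartDegree src (src (dartRev d)) = 2 ∧ src d' = src (dartRev d) ∧ d' ≠ dartRev d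

variable {src}

theorem DartNext.rev {d d' : N × Bool} (h : DartNext src d d') :
    DartNext src (dartRev d') (dartRev d) := by
  obtain ⟨h1, h2, h3⟩ := h
  refine ⟨?_, ?_, ?_⟩
  · rw [dartRev_dartRev, h2, h1]
  · rw [dartRev_dartRev, h2]
  · rw [dartRev_dartRev]; exact h3.symm

theorem filter_src_eq_pair [DecidableEq N] {w : W} (hw : dartDegree src w = 2) {d d' : N × Bool}
    (hd : src d = w) (hd' : src d' = w) (hne : d ≠ d') :
    (Finset.univ.filter fun d => src d = w) = {d, d'} := by
  refine (Finset.eq_of_subset_of_card_le (fun x hx => ?_) ?_).symm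
  · rw [Finset.mem_insert, Finset.mem_singleton] at hx
    rcases hx with rfl | rfl <;> simp [hd, hd']
  · rw [Finset.card_pair hne]; exact hw.le

/-- At a vertex of degree two, the only dart other than the reverse of the arriving one is the
continuation. -/
theorem DartNext.rightUnique : Relator.RightUnique (DartNext src) := by
  classical
  rintro d d₁ d₂ ⟨h1, h2, h3⟩ ⟨-, h2', h3'⟩
  have h := filter_src_eq_pair h1 rfl h2 h3.symm
  have hm : d₂ ∈ Finset.univ.filter fun x => src x = src (dartRev d) := by simp [h2']
  rw [h, Finset.mem_insert, Finset.mem_singleton] at hm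
  exact (hm.resolve_left h3').symm

open Relation in
theorem reflTransGen_dartNext_rev {d d' : N × Bool} (h : ReflTransGen (DartNext src) d d') :
    ReflTransGen (DartNext src) (dartRev d') (dartRev d) := by
  induction h with
  | refl => exact .refl
  | tail _ h ih => exact .head h.rev ih

open Relation in
/-- Two edges are in series if they are joined by a path through vertices of degree two. -/
def seriesSetoid (src : N × Bool → W) : Setoid N where
  r e e' := ∃ b b', ReflTransGen (DartNext src) (e, b) (e', b')
  iseqv := by
    have symm : ∀ {e e' : N}, (∃ b b', ReflTransGen (DartNext src) (e, b) (e', b')) →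
        ∃ b b', ReflTransGen (DartNext src) (e', b) (e, b') := fun ⟨b, b', h⟩ =>
      ⟨!b', !b, reflTransGen_dartNext_rev h⟩
    refine ⟨fun e => ⟨true, true, .refl⟩, symm, ?_⟩
    rintro e e' e'' ⟨b, b', h⟩ ⟨c, c', h'⟩
    rcases eq_or_eq_dartRev (d := (e', b')) (d' := (e', c)) rfl with hc | hc
    · rw [hc] at h'
      exact ⟨b, c', h.trans h'⟩
    · rw [hc] at h'
      -- The second chain leaves `e'` backwards, from the dart where the reversed first chain
      -- starts. Continuations are unique, so one of these two chains is an initial part of the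
      -- other.
      rcases ReflTransGen.total_of_right_unique DartNext.rightUnique h'
        (reflTransGen_dartNext_rev h) with h1 | h1
      · exact symm ⟨c', !b, h1⟩
      · exact ⟨!b, c', h1⟩

theorem series_of_src_eq {d d' : N × Bool} (hd : dartDegree src (src d) = 2)
    (h : src d' = src d) : (seriesSetoid src).r d.1 d'.1 := by
  by_cases hne : d' = d
  · rw [hne]
  · refine ⟨!d.2, d'.2, .single ⟨?_, ?_, ?_⟩⟩
    · rw [show src (dartRev (d.1, !d.2)) = src d by simp [dartRev], hd]
    · rw [h]; simp [dartRev]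
    · simpa [dartRev] using hne

/-- In a connected multigraph with all degrees at least two that is not a cycle, the number of
series classes of edges is at most `3 (g - 1)`. -/
theorem card_series_le [Fintype W] {g : ℕ} (hdeg : ∀ w, 2 ≤ dartDegree src w)
    (hχ : Fintype.card N + 1 ≤ Fintype.card W + g)
    (hconn : ∀ U : Set W, U.Nonempty → (∀ d, src d ∈ U → src (dartRev d) ∈ U) → U = univ)
    (hcycle : ∀ e, ∃ e', ¬ (seriesSetoid src).r e e') :
    Nat.card (Quotient (seriesSetoid src)) + 3 ≤ 3 * g := by
  classical
  let S := seriesSetoid src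
  have : Fintype (Quotient S) := Fintype.ofFinite _
  let cls : N × Bool → Quotient S := fun d => Quotient.mk S d.1
  have hcls : ∀ {d d'}, dartDegree src (src d) = 2 → src d' = src d → cls d' = cls d :=
    fun h1 h2 => (Quotient.sound (series_of_src_eq h1 h2)).symm
  -- These are the darts at branch vertices. Each series class has at least two of them, its two
  -- ends.
  let B : Finset (N × Bool) := Finset.univ.filter fun d => dartDegree src (src d) ≠ 2
  have hB : ∀ C : Quotient S, 2 ≤ (B.filter fun d => cls d = C).card := by
    intro C
    -- Each edge of the class has two darts, and at a vertex of degree two both darts lie in one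
    -- class; an even number is left for the branch vertices.
    have heven : Even (B.filter fun d => cls d = C).card := by
      have h1 : Even (Finset.univ.filter fun d => cls d = C).card := by
        have : (Finset.univ.filter fun d => cls d = C) =
            (Finset.univ.filter fun e => Quotient.mk S e = C) ×ˢ (Finset.univ : Finset Bool) := by
          ext d; simp [cls]
        rw [this, Finset.card_product]
        simp
      have h2 : Even ((Finset.univ.filter fun d => cls d = C).filter
          fun d => dartDegree src (src d) = 2).card := by
        rw [Finset.card_eq_sum_card_fiberwise (f := src) (t := Finset.univ) (by simp)]
        refine Finset.even_sum _ fun w _ => ?_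
        rcases Finset.eq_empty_or_nonempty (((Finset.univ.filter fun d => cls d = C).filter
          fun d => dartDegree src (src d) = 2).filter fun d => src d = w) with h | ⟨d, hd⟩
        · rw [h]; simp
        · simp only [Finset.mem_filter, Finset.mem_univ, true_and] at hd
          obtain ⟨⟨hdC, hd2⟩, rfl⟩ := hd
          have : (((Finset.univ.filter fun d => cls d = C).filter
              fun d => dartDegree src (src d) = 2).filter fun d' => src d' = src d) =
              Finset.univ.filter fun d' => src d' = src d := by
            ext d'
            simp only [Finset.mem_filter, Finset.mem_univ, true_and, and_iff_right_iff_imp]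
            intro h
            exact ⟨(hcls hd2 h).trans hdC, h ▸ hd2⟩
          rw [this]
          change Even (dartDegree src (src d))
          rw [hd2]; exact even_two
      rw [← Finset.card_filter_add_card_filter_not (fun d => dartDegree src (src d) = 2)] at h1
      have h3 := (Nat.even_add.1 h1).1 h2
      convert h3 using 2
      ext d
      simp [B, and_comm]
    have hpos : 0 < (B.filter fun d => cls d = C).card := by
      rw [Finset.card_pos, Finset.nonempty_iff_ne_empty]
      intro hempty
      have h2 : ∀ d, cls d = C → dartDegree src (src d) = 2 := by
        intro d hd
        by_contra hne
        have : d ∈ B.filter fun d => cls d = C := by simp [B, hne, hd]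
        rw [hempty] at this
        simp at this
      induction C using Quotient.inductionOn with
      | h e =>
        obtain ⟨e', he'⟩ := hcycle e
        -- With no branch vertex, the vertices met by the class are closed under adjacency, so
        -- connectedness puts every edge in it.
        have hU := hconn {w | ∃ d, cls d = Quotient.mk S e ∧ src d = w} ⟨_, (e, true), rfl, rfl⟩
          fun d' ⟨d, hd, hdd⟩ => ⟨dartRev d', (hcls (h2 d hd) hdd.symm).trans hd, rfl⟩
        obtain ⟨d, hd, hdd⟩ : src (e', true) ∈ {w | ∃ d, cls d = Quotient.mk S e ∧ src d = w} :=
          hU ▸ mem_univ _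
        exact he' (Quotient.exact ((hcls (h2 d hd) hdd.symm).trans hd).symm)
    obtain ⟨k, hk⟩ := heven
    omega
  have h1 : Fintype.card (Quotient S) * 2 ≤ B.card := by
    rw [Finset.card_eq_sum_card_fiberwise (f := cls) (t := Finset.univ) (by simp),
      ← smul_eq_mul, ← Finset.card_univ]
    exact Finset.card_nsmul_le_sum _ _ _ fun C _ => hB C
  -- Vertex by vertex: `0 + 6 = 3 * 2` in degree two, and `n + 6 ≤ 3 * n` in degree `n ≥ 3`.
  have h2 : B.card + 6 * Fintype.card W ≤ 3 * (2 * Fintype.card N) := by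
    have hd : (Finset.univ : Finset (N × Bool)).card = ∑ w, dartDegree src w :=
      Finset.card_eq_sum_card_fiberwise (f := src) (t := Finset.univ) (by simp)
    have hN : (Finset.univ : Finset (N × Bool)).card = 2 * Fintype.card N := by
      rw [Finset.card_univ, Fintype.card_prod, Fintype.card_bool, mul_comm]
    rw [← hN, hd, Finset.card_eq_sum_card_fiberwise (f := src) (t := Finset.univ) (by simp),
      Finset.mul_sum, mul_comm, ← smul_eq_mul, ← Finset.card_univ, ← Finset.sum_const,
      ← Finset.sum_add_distrib]
    refine Finset.sum_le_sum fun w _ => ?_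
    by_cases hw : dartDegree src w = 2
    · have : B.filter (fun d => src d = w) = ∅ := by
        rw [Finset.filter_eq_empty_iff]
        rintro d hdB rfl
        simp [B, hw] at hdB
      rw [this, hw]; simp
    · have : (B.filter fun d => src d = w).card ≤ dartDegree src w :=
        Finset.card_le_card (Finset.filter_subset_filter _ (Finset.subset_univ _))
      have := hdeg w
      omega
  rw [Nat.card_eq_fintype_card]
  change Fintype.card (Quotient S) + 3 ≤ 3 * g
  omega

end Darts

/-! ### Contraction of the bridges, and torsion points on series classes. -/

namespace MetricGraph

variable {V E : Type*} (Γ : MetricGraph V E) [Fintype E] [DecidableEq V]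

/-- The edges that lie on a cycle. -/
abbrev CycleEdge : Type _ := {e : E // Γ.edgeForm e ≠ 0}

/-- The vertices of the graph obtained by contracting the bridges. -/
abbrev BridgeQuotient : Type _ :=
  Quot fun u v : V => ∃ e, Γ.edgeForm e = 0 ∧ Γ.tail e = u ∧ Γ.head e = v

/-- The initial vertex of a dart, in the graph obtained by contracting the bridges. -/
def src (d : Γ.CycleEdge × Bool) : Γ.BridgeQuotient :=
  Quot.mk _ (if d.2 then Γ.head d.1 else Γ.tail d.1)

/-- The coordinate functional of a dart. -/
noncomputable def dartForm (d : Γ.CycleEdge × Bool) : Module.Dual ℝ Γ.cycles :=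
  if d.2 then -Γ.edgeForm d.1 else Γ.edgeForm d.1

/-- The parametrization of an edge in the direction of a dart. -/
noncomputable def dartPoint (d : Γ.CycleEdge × Bool) (t : ℝ) : Γ.Point :=
  Γ.point d.1 (if d.2 then Γ.length d.1 - t else t)

/-- The class of a vertex of the graph obtained by contracting the bridges. -/
noncomputable def bridgeQuotientClass : Γ.BridgeQuotient → Γ.PeriodQuotient :=
  Quot.lift (fun v => Γ.pointClass (.vertex v)) <| by
    rintro _ _ ⟨e, he, rfl, rfl⟩
    simp [pointClass_head, he]

variable {Γ}

theorem dartForm_rev (d : Γ.CycleEdge × Bool) : Γ.dartForm (dartRev d) = -Γ.dartForm d := by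
  obtain ⟨e, b⟩ := d
  cases b <;> simp [dartForm, dartRev]

theorem pointClass_dartPoint (d : Γ.CycleEdge × Bool) {t : ℝ}
    (ht : t ∈ Icc 0 (Γ.length d.1)) : Γ.pointClass (Γ.dartPoint d t) =
      Γ.bridgeQuotientClass (Γ.src d) - Γ.formClass (t • Γ.dartForm d) := by
  obtain ⟨e, b⟩ := d
  cases b
  · exact pointClass_point e.1 ht
  · have h := pointClass_point e.1 (t := Γ.length e - t)
      ⟨sub_nonneg.2 ht.2, sub_le_self _ ht.1⟩
    change Γ.pointClass (Γ.point e.1 (Γ.length e - t)) =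
      Γ.pointClass (.vertex (Γ.head e)) - Γ.formClass (t • -Γ.edgeForm e)
    rw [h, pointClass_head, formClass_sub_smul, smul_neg, map_neg]
    abel

theorem bridgeQuotientClass_rev (d : Γ.CycleEdge × Bool) :
    Γ.bridgeQuotientClass (Γ.src (dartRev d)) =
      Γ.bridgeQuotientClass (Γ.src d) - Γ.formClass (Γ.length d.1 • Γ.dartForm d) := by
  obtain ⟨e, b⟩ := d
  cases b
  · exact pointClass_head e.1
  · change Γ.pointClass (.vertex (Γ.tail e)) =
      Γ.pointClass (.vertex (Γ.head e)) - Γ.formClass (Γ.length e • -Γ.edgeForm e)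
    rw [pointClass_head, smul_neg, map_neg]
    abel

theorem exists_dartPoint (e : Γ.CycleEdge) (b : Bool) {t : ℝ} (ht : t ∈ Icc 0 (Γ.length e)) :
    ∃ t' ∈ Icc 0 (Γ.length e), Γ.point e t = Γ.dartPoint (e, b) t' := by
  cases b
  · exact ⟨t, ht, rfl⟩
  · refine ⟨Γ.length e - t, ⟨sub_nonneg.2 ht.2, sub_le_self _ ht.1⟩, ?_⟩
    simp [dartPoint]

theorem dartForm_ne_zero {d : Γ.CycleEdge × Bool} : Γ.dartForm d ≠ 0 := by
  obtain ⟨e, b⟩ := d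
  cases b
  · exact e.2
  · exact neg_ne_zero.2 e.2

theorem infinite_torsion_dart {d : Γ.CycleEdge × Bool} {L t : ℝ} (hL : 0 < L)
    (hLt : IsOfFinAddOrder (Γ.formClass (L • Γ.dartForm d))) (ht : t ∈ Icc 0 (Γ.length d.1))
    {q : Γ.Point} (hq : IsOfFinAddOrder (Γ.pointClass (Γ.dartPoint d t) - Γ.pointClass q)) :
    ((fun x => Γ.pointClass x - Γ.pointClass q) ''
      {x | IsOfFinAddOrder (Γ.pointClass x - Γ.pointClass q)}).Infinite := by
  obtain ⟨e, b⟩ := d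
  cases b
  · exact infinite_torsion e.2 hL hLt ht hq
  · refine infinite_torsion e.2 hL ?_ ⟨sub_nonneg.2 ht.2, sub_le_self _ ht.1⟩ hq
    have : Γ.formClass (L • Γ.dartForm (e, true)) = -Γ.formClass (L • Γ.edgeForm e) := by
      simp [dartForm]
    rwa [this, isOfFinAddOrder_neg_iff] at hLt

theorem bridgeQuotient_connected (U : Set Γ.BridgeQuotient) (hU : U.Nonempty)
    (h : ∀ d, Γ.src d ∈ U → Γ.src (dartRev d) ∈ U) : U = univ := by
  have hedge : ∀ e, (Quot.mk _ (Γ.tail e) : Γ.BridgeQuotient) ∈ U ↔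
      (Quot.mk _ (Γ.head e) : Γ.BridgeQuotient) ∈ U := by
    intro e
    by_cases he : Γ.edgeForm e = 0
    · rw [Quot.sound ⟨e, he, rfl, rfl⟩]
    · exact ⟨h (⟨e, he⟩, false), h (⟨e, he⟩, true)⟩
  have hall : ∀ u v : V, (Quot.mk _ u : Γ.BridgeQuotient) ∈ U ↔
      (Quot.mk _ v : Γ.BridgeQuotient) ∈ U := by
    intro u v
    induction Γ.connected u v with
    | rel u v h =>
      obtain ⟨e, rfl, rfl⟩ := h
      exact hedge e
    | refl => rfl
    | symm _ _ _ ih => exact ih.symm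
    | trans _ _ _ _ _ ih ih' => exact ih.trans ih'
  obtain ⟨w, hw⟩ := hU
  induction w using Quot.ind with
  | mk u => exact eq_univ_of_forall (Quot.ind fun v => (hall u v).1 hw)

/-- Boundaries have total coefficient zero, so the boundary map is not surjective; rank and nullity
give the bound. -/
theorem card_edge_add_one_le [Fintype V] : Fintype.card E + 1 ≤ Fintype.card V + Γ.genus := by
  have h1 := LinearMap.finrank_range_add_finrank_ker Γ.boundary
  rw [Module.finrank_fintype_fun_eq_card] at h1
  change _ + Γ.genus = _ at h1
  have h2 : Module.finrank ℝ (LinearMap.range Γ.boundary) < Fintype.card V := by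
    rw [← Module.finrank_fintype_fun_eq_card ℝ]
    refine Submodule.finrank_lt fun htop => ?_
    obtain ⟨v⟩ := Γ.nonempty
    obtain ⟨ω, hω⟩ : Pi.single v 1 ∈ LinearMap.range Γ.boundary := htop ▸ Submodule.mem_top
    have h3 : ∑ u, Γ.boundary ω u = 0 := by
      simp only [boundary_apply]
      rw [Finset.sum_comm]
      simp [← Finset.mul_sum]
    rw [hω] at h3
    simp at h3
  omega

/-- Rank and nullity for the coboundary restricted to bridges: its kernel consists of functions
constant along bridges, which descend to the quotient. -/
theorem card_vertex_le [Fintype V] [Fintype Γ.BridgeQuotient] [Fintype {e : E // Γ.edgeForm e = 0}] :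
    Fintype.card V ≤ Fintype.card Γ.BridgeQuotient + Fintype.card {e : E // Γ.edgeForm e = 0} := by
  let δ : (V → ℝ) →ₗ[ℝ] ({e : E // Γ.edgeForm e = 0} → ℝ) :=
    LinearMap.pi fun e => LinearMap.proj (R := ℝ) (φ := fun _ : V => ℝ) (Γ.head e.1) -
      LinearMap.proj (R := ℝ) (φ := fun _ : V => ℝ) (Γ.tail e.1)
  have h1 := LinearMap.finrank_range_add_finrank_ker δ
  have h2 := Submodule.finrank_le (LinearMap.range δ)
  have h3 : LinearMap.ker δ ≤ LinearMap.range
      (LinearMap.funLeft ℝ ℝ (fun v : V => (Quot.mk _ v : Γ.BridgeQuotient))) := by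
    intro h hh
    refine ⟨Quot.lift h ?_, rfl⟩
    rintro _ _ ⟨e, he, rfl, rfl⟩
    have := congrFun (LinearMap.mem_ker.1 hh) ⟨e, he⟩
    exact (sub_eq_zero.1 this).symm
  have h4 := (Submodule.finrank_mono h3).trans (LinearMap.finrank_range_le _)
  rw [Module.finrank_fintype_fun_eq_card] at h1 h2 h4
  change _ ≤ Fintype.card Γ.BridgeQuotient at h4
  omega

theorem card_cycleEdge_add_one_le [Fintype V] [Fintype Γ.CycleEdge] [Fintype Γ.BridgeQuotient] :
    Fintype.card Γ.CycleEdge + 1 ≤ Fintype.card Γ.BridgeQuotient + Γ.genus := by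
  classical
  have h1 := card_edge_add_one_le (Γ := Γ)
  have h2 := card_vertex_le (Γ := Γ)
  have h3 := Fintype.card_subtype_compl fun e : E => Γ.edgeForm e = 0
  have h4 := Fintype.card_subtype_le fun e : E => Γ.edgeForm e = 0
  have h5 : Fintype.card Γ.CycleEdge = Fintype.card {e // ¬ Γ.edgeForm e = 0} :=
    Fintype.card_congr (.refl _)
  omega

section Finite

variable [Fintype V] [Fintype Γ.CycleEdge] [DecidableEq Γ.BridgeQuotient]

/-- Conservation of flow at a vertex of the graph obtained by contracting the bridges. -/
theorem sum_dartForm (w : Γ.BridgeQuotient) :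
    ∑ d ∈ Finset.univ.filter (fun d => Γ.src d = w), Γ.dartForm d = 0 := by
  classical
  refine LinearMap.ext fun ω => ?_
  -- The potential is the indicator of the vertices contracted to `w`; its coboundary counts the
  -- flow through `w`.
  have h := sum_potential (fun v => if (Quot.mk _ v : Γ.BridgeQuotient) = w then (1 : ℝ) else 0) ω
  rw [← Finset.sum_subset (Finset.subset_univ (Finset.univ.filter fun e => Γ.edgeForm e ≠ 0))
    (fun e _ he => by
      have he : Γ.edgeForm e = 0 := by simpa using he
      rw [← edgeForm_apply, he, LinearMap.zero_apply, zero_mul]),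
    Finset.sum_subtype (p := fun e => Γ.edgeForm e ≠ 0) _ (by simp), ← neg_eq_zero,
    ← Finset.sum_neg_distrib] at h
  rw [LinearMap.zero_apply, ← h, Finset.sum_filter, LinearMap.sum_apply, Fintype.sum_prod_type]
  refine Finset.sum_congr rfl fun e _ => ?_
  simp only [Fintype.sum_bool, src, dartForm, if_true, Bool.false_eq_true, if_false]
  split_ifs <;> simp [edgeForm_apply]

/-- At a vertex of degree two, conservation of flow has two terms, so what enters along `d` leaves
along `d'`. -/
theorem dartForm_eq_of_next {d d' : Γ.CycleEdge × Bool} (h : DartNext Γ.src d d') :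
    Γ.dartForm d' = Γ.dartForm d := by
  classical
  obtain ⟨h1, h2, h3⟩ := h
  have := sum_dartForm (Γ.src (dartRev d))
  rw [filter_src_eq_pair h1 rfl h2 h3.symm, Finset.sum_pair h3.symm, dartForm_rev] at this
  rwa [neg_add_eq_zero, eq_comm] at this

open Relation in
theorem dartForm_eq_of_reflTransGen {d d' : Γ.CycleEdge × Bool}
    (h : ReflTransGen (DartNext Γ.src) d d') : Γ.dartForm d' = Γ.dartForm d := by
  induction h with
  | refl => rfl
  | tail _ h ih => rw [dartForm_eq_of_next h, ih]

open Relation in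
/-- The distance along a path through vertices of degree two. -/
theorem exists_distance {d d' : Γ.CycleEdge × Bool} (h : ReflTransGen (DartNext Γ.src) d d') :
    d = d' ∨ ∃ L : ℝ, 0 ≤ L ∧ Γ.bridgeQuotientClass (Γ.src d') =
      Γ.bridgeQuotientClass (Γ.src (dartRev d)) - Γ.formClass (L • Γ.dartForm d) := by
  induction h with
  | refl => exact .inl rfl
  | @tail d' d'' h h' ih =>
    right
    rcases ih with rfl | ⟨L, hL, ih⟩
    -- `L` measures from the end of `d` to the start of `d'`, hence `0` for adjacent darts.
    · exact ⟨0, le_rfl, by rw [h'.2.1]; simp⟩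
    · refine ⟨L + Γ.length d'.1, add_nonneg hL (Γ.length_pos _).le, ?_⟩
      rw [h'.2.1, bridgeQuotientClass_rev, ih, dartForm_eq_of_reflTransGen h, add_smul, map_add]
      abel

/-- If there are finitely many torsion points, then there is at most one on each series class. -/
theorem pointClass_eq_of_series {q : Γ.Point}
    (hfin : ((fun x => Γ.pointClass x - Γ.pointClass q) ''
      {x | IsOfFinAddOrder (Γ.pointClass x - Γ.pointClass q)}).Finite)
    {e e' : Γ.CycleEdge} (hee : (seriesSetoid Γ.src).r e e') {t t' : ℝ}
    (ht : t ∈ Icc 0 (Γ.length e)) (ht' : t' ∈ Icc 0 (Γ.length e'))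
    (h : IsOfFinAddOrder (Γ.pointClass (Γ.point e t) - Γ.pointClass q))
    (h' : IsOfFinAddOrder (Γ.pointClass (Γ.point e' t') - Γ.pointClass q)) :
    Γ.pointClass (Γ.point e t) = Γ.pointClass (Γ.point e' t') := by
  -- A positive displacement `L` between two torsion positions would be a torsion functional,
  -- forcing infinitely many torsion points; so `L = 0`.
  have key : ∀ (d : Γ.CycleEdge × Bool) (s L : ℝ) (c : Γ.PeriodQuotient),
      s ∈ Icc 0 (Γ.length d.1) → 0 ≤ L →
      IsOfFinAddOrder (Γ.pointClass (Γ.dartPoint d s) - Γ.pointClass q) →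
      IsOfFinAddOrder (c - Γ.pointClass q) →
      c = Γ.pointClass (Γ.dartPoint d s) - Γ.formClass (L • Γ.dartForm d) →
      Γ.pointClass (Γ.dartPoint d s) = c := by
    intro d s L c hs hL h h' hc
    rcases hL.eq_or_lt with rfl | hL
    · simp [hc]
    · refine absurd hfin (infinite_torsion_dart hL ?_ hs h)
      have : Γ.formClass (L • Γ.dartForm d) =
          (Γ.pointClass (Γ.dartPoint d s) - Γ.pointClass q) + -(c - Γ.pointClass q) := by
        rw [hc]; abel
      rw [this]
      exact h.add h'.neg
  obtain ⟨b, b', hbb⟩ := hee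
  obtain ⟨s, hs, hse⟩ := exists_dartPoint e b ht
  obtain ⟨s', hs', hse'⟩ := exists_dartPoint e' b' ht'
  rw [hse] at h ⊢
  rw [hse'] at h' ⊢
  rcases exists_distance hbb with heq | ⟨L, hL, hLe⟩
  · obtain ⟨rfl, rfl⟩ := Prod.mk.inj heq
    rcases le_total s s' with hss | hss
    · refine key _ s (s' - s) _ hs (sub_nonneg.2 hss) h h' ?_
      rw [pointClass_dartPoint _ (t := s) hs, pointClass_dartPoint _ (t := s') hs', formClass_sub_smul]
      abel
    · refine (key _ s' (s - s') _ hs' (sub_nonneg.2 hss) h' h ?_).symm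
      rw [pointClass_dartPoint _ (t := s) hs, pointClass_dartPoint _ (t := s') hs', formClass_sub_smul]
      abel
  · have h0 : 0 ≤ Γ.length e - s := sub_nonneg.2 hs.2
    -- The displacement is the rest of the first edge, the edges in between, and the initial part of
    -- the last edge.
    refine key _ s ((Γ.length e - s) + (L + s')) _ hs (by linarith [hs'.1]) h h' ?_
    rw [pointClass_dartPoint _ (t := s) hs, pointClass_dartPoint _ (t := s') hs', hLe, bridgeQuotientClass_rev,
      dartForm_eq_of_reflTransGen hbb, add_smul, add_smul, map_add, map_add, formClass_sub_smul]
    abel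

/-- Degree zero contradicts connectedness. In degree one, conservation of flow would kill the
functional of the only dart, making its edge a bridge. -/
theorem two_le_dartDegree (e₀ : Γ.CycleEdge) (w : Γ.BridgeQuotient) :
    2 ≤ dartDegree Γ.src w := by
  by_contra! hlt
  have hsum := sum_dartForm w
  rcases (by omega : dartDegree Γ.src w = 0 ∨ dartDegree Γ.src w = 1) with h | h
  · have h : ∀ d, Γ.src d ≠ w := by
      simpa [dartDegree, Finset.card_eq_zero, Finset.filter_eq_empty_iff] using h
    have := bridgeQuotient_connected {w}ᶜ ⟨_, h (e₀, true)⟩ fun d _ => h _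
    exact (this ▸ mem_univ w : w ∈ ({w}ᶜ : Set _)) rfl
  · obtain ⟨d, hd⟩ := Finset.card_eq_one.1 h
    rw [hd, Finset.sum_singleton] at hsum
    exact dartForm_ne_zero hsum

/-- Classes are constant along bridges, and every vertex of the contracted graph is an end of a
cycle edge. -/
theorem exists_cycleEdge_point (e₀ : Γ.CycleEdge) (x : Γ.Point) :
    ∃ e : Γ.CycleEdge, ∃ t ∈ Icc 0 (Γ.length e), Γ.pointClass x = Γ.pointClass (Γ.point e t) := by
  have hvertex : ∀ v, ∃ e : Γ.CycleEdge, ∃ t ∈ Icc 0 (Γ.length e),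
      Γ.pointClass (.vertex v) = Γ.pointClass (Γ.point e t) := by
    intro v
    have h : 0 < dartDegree Γ.src (Quot.mk _ v) := two_pos.trans_le (two_le_dartDegree e₀ _)
    obtain ⟨d, hd⟩ := Finset.card_pos.1 h
    have hd : Γ.src d = Quot.mk _ v := by simpa using hd
    refine ⟨d.1, if d.2 then Γ.length d.1 - 0 else 0, ?_, ?_⟩
    · have := (Γ.length_pos d.1).le
      split_ifs <;> simp [this]
    · change _ = Γ.pointClass (Γ.dartPoint d 0)
      rw [pointClass_dartPoint d ⟨le_rfl, (Γ.length_pos _).le⟩, hd, zero_smul, map_zero, sub_zero]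
      rfl
  cases x with
  | vertex v => exact hvertex v
  | interior e t ht =>
    by_cases he : Γ.edgeForm e = 0
    · obtain ⟨e', t', ht', h⟩ := hvertex (Γ.tail e)
      refine ⟨e', t', ht', ?_⟩
      rw [← h, ← point_interior e ht, pointClass_point e (Ioo_subset_Icc_self ht), he]
      simp
    · exact ⟨⟨e, he⟩, t, Ioo_subset_Icc_self ht, by rw [point_interior e ht]⟩

/-- If all cycle edges were in series with `e`, every coordinate of a cycle would be zero or, up to
sign, its coordinate at `e`, so the genus would be at most one. -/
theorem exists_not_series (hg : 2 ≤ Γ.genus) (e : Γ.CycleEdge) :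
    ∃ e', ¬ (seriesSetoid Γ.src).r e e' := by
  by_contra! hall
  have hker : LinearMap.ker (Γ.edgeForm e) = ⊥ := by
    rw [LinearMap.ker_eq_bot']
    intro ω hω
    refine Subtype.ext (funext fun e' => ?_)
    change Γ.edgeForm e' ω = 0
    by_cases he' : Γ.edgeForm e' = 0
    · rw [he', LinearMap.zero_apply]
    · obtain ⟨b, b', h⟩ := hall ⟨e', he'⟩
      have h := congrArg (· ω) (dartForm_eq_of_reflTransGen h)
      cases b <;> cases b' <;> simpa [dartForm, hω] using h
  have := LinearMap.finrank_le_finrank_of_injective (LinearMap.ker_eq_bot.1 hker)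
  rw [Module.finrank_self] at this
  exact absurd (hg.trans this) (by norm_num)

end Finite

theorem exists_edgeForm_ne_zero (hg : 2 ≤ Γ.genus) : ∃ e, Γ.edgeForm e ≠ 0 := by
  by_contra! hall
  have : Subsingleton Γ.cycles := ⟨fun ω ω' => Subtype.ext (funext fun e => by
    rw [← edgeForm_apply, ← edgeForm_apply, hall]; rfl)⟩
  have h0 : Γ.genus = 0 := Module.finrank_zero_of_subsingleton (R := ℝ) (M := Γ.cycles)
  omega

theorem ncard_torsion_le [Fintype V] (hg : 2 ≤ Γ.genus) (q : Γ.Point)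
    (hfin : ((fun x => Γ.pointClass x - Γ.pointClass q) ''
      {x | IsOfFinAddOrder (Γ.pointClass x - Γ.pointClass q)}).Finite) :
    ((fun x => Γ.pointClass x - Γ.pointClass q) ''
      {x | IsOfFinAddOrder (Γ.pointClass x - Γ.pointClass q)}).ncard ≤ 3 * Γ.genus - 3 := by
  classical
  have : Finite Γ.BridgeQuotient := Quot.finite _
  have : Fintype Γ.BridgeQuotient := Fintype.ofFinite _
  obtain ⟨e₀, he₀⟩ := exists_edgeForm_ne_zero hg
  have hcard := card_series_le (two_le_dartDegree ⟨e₀, he₀⟩) card_cycleEdge_add_one_le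
    bridgeQuotient_connected (exists_not_series hg)
  set T := (fun x => Γ.pointClass x - Γ.pointClass q) ''
    {x | IsOfFinAddOrder (Γ.pointClass x - Γ.pointClass q)} with hT
  have hex : ∀ c : T, ∃ e : Γ.CycleEdge, ∃ t ∈ Icc 0 (Γ.length e),
      c.1 = Γ.pointClass (Γ.point e t) - Γ.pointClass q ∧
        IsOfFinAddOrder (Γ.pointClass (Γ.point e t) - Γ.pointClass q) := by
    rintro ⟨_, x, hx, rfl⟩
    obtain ⟨e, t, ht, h⟩ := exists_cycleEdge_point ⟨e₀, he₀⟩ x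
    exact ⟨e, t, ht, by simp only [h], h ▸ hx⟩
  choose e t ht heq htors using hex
  -- Choosing for each torsion class a cycle edge that carries it gives an injection into the series
  -- classes.
  have hinj : Function.Injective fun c => Quotient.mk (seriesSetoid Γ.src) (e c) := by
    intro c c' h
    refine Subtype.ext ?_
    rw [heq c, heq c', pointClass_eq_of_series hfin (Quotient.exact h) (ht c) (ht c') (htors c)
      (htors c')]
  have := Nat.card_le_card_of_injective _ hinj
  rw [Nat.card_coe_set_eq] at this
  omega

end MetricGraph

theorem mainTheorem3 {V E : Type*} [Fintype V] [Fintype E] [DecidableEq V]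
    (Γ : MetricGraph V E) (hg : 2 ≤ Γ.genus) (q : Γ.Point)
    (hfin : (Set.range (Γ.abelJacobi q) ∩ (AddCommGroup.torsion Γ.Jac : Set Γ.Jac)).Finite) :
    (Set.range (Γ.abelJacobi q) ∩ (AddCommGroup.torsion Γ.Jac : Set Γ.Jac)).ncard
      ≤ 3 * Γ.genus - 3 := by
  -- An injective homomorphism preserves and reflects finite order, so the count can be made in the
  -- period quotient.
  have himage : Γ.jacPeriod ''
      (Set.range (Γ.abelJacobi q) ∩ (AddCommGroup.torsion Γ.Jac : Set Γ.Jac)) =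
      (fun x => Γ.pointClass x - Γ.pointClass q) ''
        {x | IsOfFinAddOrder (Γ.pointClass x - Γ.pointClass q)} := by
    have htors : ∀ x, Γ.abelJacobi q x ∈ (AddCommGroup.torsion Γ.Jac : Set Γ.Jac) ↔
        IsOfFinAddOrder (Γ.pointClass x - Γ.pointClass q) := by
      intro x
      rw [← MetricGraph.jacPeriod_abelJacobi]
      exact (MetricGraph.jacPeriod_injective.isOfFinAddOrder_iff (f := Γ.jacPeriod)).symm
    ext c
    constructor
    · rintro ⟨_, ⟨⟨x, rfl⟩, hx⟩, rfl⟩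
      exact ⟨x, (htors x).1 hx, (MetricGraph.jacPeriod_abelJacobi q x).symm⟩
    · rintro ⟨x, hx, rfl⟩
      exact ⟨_, ⟨⟨x, rfl⟩, (htors x).2 hx⟩, MetricGraph.jacPeriod_abelJacobi q x⟩
  rw [← Set.ncard_image_of_injective _ MetricGraph.jacPeriod_injective, himage]
  exact MetricGraph.ncard_torsion_le hg q (himage ▸ hfin.image _)
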